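/- Let $\mathbf P_0$ be a probability law on a measurable space $\mathfrak X$ and, under $H_0$, let $\varepsilon_1,\dots,\varepsilon_n$ be i.i.d. with law $\mathbf P_0$ (for every $n$; the sequences for different $n$ may live on different probability spaces). $\mathbf E_{H_0},\mathbf D_{H_0},\mathrm{cov}_{H_0}$ are computed for an i.i.d. sequence with law $\mathbf P_0$. For $1\le q\le Q$ fix natural numbers $m_{sum}^{[q]},m_{lb}^{[q]},N_{lb}^{[q]},L_{sb}^{[q]},K_{sb}^{[q]}$, functions $f_{sum}^{[q]}:\mathfrak X^{m_{sum}^{[q]}}\to\mathbb R$, $f_{lb}^{[q]}:\mathfrak X^{m_{lb}^{[q]}}\to\mathbb R$, $f_{sb}^{[q]}:\mathfrak X^{L_{sb}^{[q]}}\to\mathbb R$ (no boundedness is assumed) and a partition of the range of $f_{sb}^{[q]}$ into nonempty sets $\alpha_{sb}^{[q]}(0),\dots,\alpha_{sb}^{[q]}(K_{sb}^{[q]})$. Dropping the superscript $[q]$, for $f=f_{sum}$, $m=m_{sum}$ put $E_{sum}=\mathbf E_{H_0}f(\varepsilon_1,\dots,\varepsilon_m)$ and $$\sigma_{sum}^2=\mathbf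 D_{H_0}f(\varepsilon_1,\dots,\varepsilon_m)+2\sum_{i=2}^{m}\mathrm{cov}_{H_0}\big(f(\varepsilon_i,\dots,\varepsilon_{i+m-1}),f(\varepsilon_1,\dots,\varepsilon_m)\big),\quad \sigma_{sum}\ge0;$$ define $E_{lb},\sigma_{lb}$ in the same way from $f_{lb},m_{lb}$, and $E_{sb}(j)=\mathbf P_{H_0}(f_{sb}(\varepsilon_1,\dots,\varepsilon_{L_{sb}})\in\alpha_{sb}(j))$. Assume $\sigma_{sum},\sigma_{lb}\in(0,\infty)$ (in particular $f_{sum}(\varepsilon_1,\dots,\varepsilon_{m_{sum}})$ and $f_{lb}(\varepsilon_1,\dots,\varepsilon_{m_{lb}})$ have finite variance) and $E_{sb}(j)>0$ for all $j$. With $L_{lb}=[n/N_{lb}]$, $N_{sb}=[n/L_{sb}]$, $W_k=\sum_{j=L_{lb}(k-1)+1}^{L_{lb}k-m_{lb}+1}f_{lb}(\varepsilon_j,\dots,\varepsilon_{j+m_{lb}-1})$ and $w(j)=\#\{1\le i\le N_{sb}: f_{sb}(\varepsilon_{L_{sb}(i-1)+1},\dots,\varepsilon_{L_{sb}i})\in\alpha_{sb}(j)\}$,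 put $$T_{sum}=\frac{\sum_{i=1}^{n-m_{sum}+1}\big(f_{sum}(\varepsilon_i,\dots,\varepsilon_{i+m_{sum}-1})-E_{sum}\big)}{\sigma_{sum}\sqrt{n-m_{sum}+1}},\quad T_{lb}=\frac{\sum_{k=1}^{N_{lb}}(W_k-(L_{lb}-m_{lb}+1)E_{lb})^2}{L_{lb}\sigma_{lb}^2},\quad T_{sb}=\sum_{j=0}^{K_{sb}}\frac{(w(j)-N_{sb}E_{sb}(j))^2}{N_{sb}E_{sb}(j)}.$$ For $1\le j\le J$ (where $J\ge 0$), given real numbers $d^{[j]}(i,q)$ ($1\le i\le\tau^{[j]}$, $1\le q\le Q$), put $T_{quad}^{[j]}=\sum_{i=1}^{\tau^{[j]}}\big(\sum_{q=1}^Q d^{[j]}(i,q)T_{sum}^{[q]}\big)^2$. Let $N,s,h$ be natural numbers with $N_{lb}^{[q]}\mid N$ and $L_{sb}^{[q]}\mid h$ for all $q$, and $s\ge h+\max_q\max(m_{sum}^{[q]},m_{lb}^{[q]})-1$. Index the coordinates of vectors in $\mathbb R^{K^*}$, $K^*=\sum_q(K_{sb}^{[q]}+3)$, by pairs $(q,j)$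 with $1\le q\le Q$, $0\le j\le K_{sb}^{[q]}+2$, and let $f^*:\mathfrak X^s\to\mathbb R^{K^*}$ have coordinates (with superscript $[q]$ dropped on the right) $$f^*_{(q,j)}(\theta_1,\dots,\theta_s)=\begin{cases}E_{sb}(j)^{-1/2}\sum_{u=1}^{h/L_{sb}}I\{f_{sb}(\theta_{L_{sb}(u-1)+1},\dots,\theta_{L_{sb}u})\in\alpha_{sb}(j)\},&0\le j\le K_{sb},\\ \sigma_{lb}^{-1}\sum_{u=1}^h f_{lb}(\theta_u,\dots,\theta_{u+m_{lb}-1}),&j=K_{sb}+1,\\ \sigma_{sum}^{-1}\sum_{u=1}^h f_{sum}(\theta_u,\dots,\theta_{u+m_{sum}-1}),&j=K_{sb}+2.\end{cases}$$ Put $Z^*_i=f^*(\varepsilon_{h(i-1)+1},\dots,\varepsilon_{h(i-1)+s})$, $$\Phi^*=\mathbf D_{H_0}Z^*_1+\sum_{2\le i\le\frac{s-1}h+1}\big(\mathrm{cov}_{H_0}(Z_1^*,Z_i^*)+\mathrm{cov}_{H_0}(Z_1^*,Z_i^*)^{\top}\big),$$ and, with $L=[n/N]$, for $1\le k\le N$,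 $$\mathcal X^*_k=\frac1{\sqrt n}\sum_{\frac{L(k-1)}h\le i\le\frac{Lk-s}h}\big(f^*(\varepsilon_{hi+1},\dots,\varepsilon_{hi+s})-\mathbf E_{H_0}f^*(\varepsilon_1,\dots,\varepsilon_s)\big).$$ Let $\eta^*_1,\dots,\eta^*_N$ be independent random vectors with law $\mathcal N(0,\frac1{Nh}\Phi^*)$, and for $1\le k\le N_{lb}^{[q]}$, $0\le j\le K_{sb}^{[q]}+2$ put, with $M_q=N/N_{lb}^{[q]}$, $$\mathcal Y_k^{[q]}(j)=\sum_{i=1}^{M_q}\mathcal X^*_{M_q(k-1)+i}(q,j),\qquad \zeta_k^{[q]}(j)=\sum_{i=1}^{M_q}\eta^*_{M_q(k-1)+i}(q,j).$$ Then, under $H_0$, with all the parameters above fixed and $n\to\infty$, for all $1\le q\le Q$ and $1\le j\le J$: $$T_{sum}^{[q]}=\sum_{k}\mathcal Y_k^{[q]}(K_{sb}^{[q]}+2)+o_P(1),\qquad T_{lb}^{[q]}=N_{lb}^{[q]}\sum_{k}\big(\mathcal Y_k^{[q]}(K_{sb}^{[q]}+1)\big)^2+o_P(1),$$ $$T_{sb}^{[q]}=L_{sb}^{[q]}\sum_{i=0}^{K_{sb}^{[q]}}\Big(\sum_{k}\mathcal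 Y_k^{[q]}(i)\Big)^2+o_P(1),\qquad T_{quad}^{[j]}=\sum_{i=1}^{\tau^{[j]}}\Big(\sum_{q=1}^Q d^{[j]}(i,q)\sum_{k}\mathcal Y_k^{[q]}(K_{sb}^{[q]}+2)\Big)^2+o_P(1)$$ (sums over $1\le k\le N_{lb}^{[q]}$); the vector of all $\mathcal Y_k^{[q]}$ ($1\le q\le Q$, $1\le k\le N_{lb}^{[q]}$) converges in distribution to the vector of all $\zeta_k^{[q]}$; and the vector $$\big(T_{sum}^{[1]},T_{lb}^{[1]},T_{sb}^{[1]},\dots,T_{sum}^{[Q]},T_{lb}^{[Q]},T_{sb}^{[Q]},T_{quad}^{[1]},\dots,T_{quad}^{[J]}\big)$$ converges in distribution to the vector with the corresponding components $$\sum_{k}\zeta_k^{[q]}(K_{sb}^{[q]}+2),\quad N_{lb}^{[q]}\sum_{k}\big(\zeta_k^{[q]}(K_{sb}^{[q]}+1)\big)^2,\quad L_{sb}^{[q]}\sum_{i=0}^{K_{sb}^{[q]}}\Big(\sum_{k}\zeta_k^{[q]}(i)\Big)^2,\quad \theta^{[j]}=\sum_{i=1}^{\tau^{[j]}}\Big(\sum_{q=1}^Q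 d^{[j]}(i,q)\sum_{k}\zeta_k^{[q]}(K_{sb}^{[q]}+2)\Big)^2.$$ -/

import Mathlib

open MeasureTheory ProbabilityTheory Filter Topology

noncomputable section

namespace JointLimit

/-- The law under `H₀` of an infinite i.i.d. sequence `ε₁, ε₂, …` with common law `P₀`.
A sequence is coded as `x : ℕ → 𝔛`, with `x i` standing for `ε_{i+1}`. -/
def iidLaw {𝔛 : Type*} [MeasurableSpace 𝔛] (P₀ : Measure 𝔛) : Measure (ℕ → 𝔛) :=
  Measure.infinitePi (fun _ : ℕ => P₀)

/-- The `m` consecutive elements `x i, …, x (i + m - 1)` of a sequence. -/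
def window {𝔛 : Type*} (m i : ℕ) (x : ℕ → 𝔛) : Fin m → 𝔛 := fun u => x (i + u)

/-- `E_{H₀} f(ε₁, …, ε_m)`. -/
def meanH0 {𝔛 : Type*} [MeasurableSpace 𝔛] (P₀ : Measure 𝔛) {m : ℕ}
    (f : (Fin m → 𝔛) → ℝ) : ℝ :=
  ∫ x, f (window m 0 x) ∂(iidLaw P₀)

/-- `D_{H₀} f(ε₁, …, ε_m) + 2 ∑_{i=2}^m cov_{H₀}(f(ε_i, …, ε_{i+m-1}), f(ε₁, …, ε_m))`. -/
def asympVar {𝔛 : Type*} [MeasurableSpace 𝔛] (P₀ : Measure 𝔛) {m : ℕ}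
    (f : (Fin m → 𝔛) → ℝ) : ℝ :=
  Var[fun x => f (window m 0 x); iidLaw P₀] +
    2 * ∑ i ∈ Finset.Icc 2 m,
      cov[fun x => f (window m (i - 1) x), fun x => f (window m 0 x); iidLaw P₀]

/-- The parameters of a triple (summing, long-block, short-block) of statistics. -/
structure TripleParams (𝔛 : Type*) [MeasurableSpace 𝔛] where
  mSum : ℕ
  mLb : ℕ
  /-- the number of long blocks -/
  NLb : ℕ
  /-- the length of short blocks -/
  LSb : ℕ
  KSb : ℕ
  mSum_pos : 0 < mSum
  mLb_pos : 0 < mLb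
  NLb_pos : 0 < NLb
  LSb_pos : 0 < LSb
  fSum : (Fin mSum → 𝔛) → ℝ
  fLb : (Fin mLb → 𝔛) → ℝ
  fSb : (Fin LSb → 𝔛) → ℝ
  /-- the partition of the set of values of `fSb` into `KSb + 1` parts -/
  α : Fin (KSb + 1) → Set ℝ
  α_nonempty : ∀ j, (α j).Nonempty
  α_disjoint : Pairwise fun i j => Disjoint (α i) (α j)
  α_union : ⋃ j, α j = Set.range fSb
  measurable_fSum : Measurable fSum
  measurable_fLb : Measurable fLb
  measurableSet_preimage : ∀ j, MeasurableSet (fSb ⁻¹' α j)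

namespace TripleParams

variable {𝔛 : Type*} [MeasurableSpace 𝔛]

def σSum (p : TripleParams 𝔛) (P₀ : Measure 𝔛) : ℝ := √(asympVar P₀ p.fSum)

def σLb (p : TripleParams 𝔛) (P₀ : Measure 𝔛) : ℝ := √(asympVar P₀ p.fLb)

/-- `P_{H₀}(f_sb(ε₁, …, ε_{L_sb}) ∈ α_sb(j))`. -/
def ESb (p : TripleParams 𝔛) (P₀ : Measure 𝔛) (j : Fin (p.KSb + 1)) : ℝ :=
  (iidLaw P₀).real {x | p.fSb (window p.LSb 0 x) ∈ p.α j}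

/-- The three statistics are well defined: `σ_sum, σ_lb ∈ (0, ∞)` (in particular the variances of
`f_sum(ε₁, …)` and `f_lb(ε₁, …)` are finite) and `E_sb(j) > 0` for all `j`. -/
structure WellDefined (p : TripleParams 𝔛) (P₀ : Measure 𝔛) : Prop where
  memLp_sum : MemLp (fun x => p.fSum (window p.mSum 0 x)) 2 (iidLaw P₀)
  memLp_lb : MemLp (fun x => p.fLb (window p.mLb 0 x)) 2 (iidLaw P₀)
  asympVar_sum_pos : 0 < asympVar P₀ p.fSum
  asympVar_lb_pos : 0 < asympVar P₀ p.fLb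
  ESb_pos : ∀ j, 0 < p.ESb P₀ j

/-- The summing statistic of the first `n` elements of `x`. -/
def TSum (p : TripleParams 𝔛) (P₀ : Measure 𝔛) (n : ℕ) (x : ℕ → 𝔛) : ℝ :=
  (∑ i ∈ Finset.range (n + 1 - p.mSum), (p.fSum (window p.mSum i x) - meanH0 P₀ p.fSum)) /
    (p.σSum P₀ * √((n : ℝ) - p.mSum + 1))

/-- `W_{k+1}`: the sum of `f_lb` over the windows contained in the long block number `k`
(counted from zero), the long blocks having length `⌊n / N_lb⌋`. -/
def W (p : TripleParams 𝔛) (n k : ℕ) (x : ℕ → 𝔛) : ℝ :=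
  ∑ i ∈ Finset.range (n / p.NLb + 1 - p.mLb), p.fLb (window p.mLb (n / p.NLb * k + i) x)

/-- The long-block statistic of the first `n` elements of `x`. -/
def TLb (p : TripleParams 𝔛) (P₀ : Measure 𝔛) (n : ℕ) (x : ℕ → 𝔛) : ℝ :=
  (∑ k ∈ Finset.range p.NLb,
      (p.W n k x - (((n / p.NLb : ℕ) : ℝ) - p.mLb + 1) * meanH0 P₀ p.fLb) ^ 2) /
    (((n / p.NLb : ℕ) : ℝ) * p.σLb P₀ ^ 2)

/-- `w(j)`: the number of short blocks, out of `⌊n / L_sb⌋`, on which `f_sb` lies in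
`α_sb(j)`. -/
def w (p : TripleParams 𝔛) (n : ℕ) (j : Fin (p.KSb + 1)) (x : ℕ → 𝔛) : ℝ :=
  ∑ i ∈ Finset.range (n / p.LSb),
    (p.fSb ⁻¹' p.α j).indicator (fun _ => (1 : ℝ)) (window p.LSb (p.LSb * i) x)

/-- The short-block statistic of the first `n` elements of `x`. -/
def TSb (p : TripleParams 𝔛) (P₀ : Measure 𝔛) (n : ℕ) (x : ℕ → 𝔛) : ℝ :=
  ∑ j : Fin (p.KSb + 1),
    (p.w n j x - ((n / p.LSb : ℕ) : ℝ) * p.ESb P₀ j) ^ 2 /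
      (((n / p.LSb : ℕ) : ℝ) * p.ESb P₀ j)

/-- The coordinates `f_j`, `0 ≤ j ≤ K_sb + 2`; they depend only on the first
`h + max(m_sum, m_lb) - 1` elements of `x` (when `L_sb ∣ h`). -/
def coord (p : TripleParams 𝔛) (P₀ : Measure 𝔛) (h : ℕ) (j : Fin (p.KSb + 3))
    (x : ℕ → 𝔛) : ℝ :=
  if hj : (j : ℕ) < p.KSb + 1 then
    1 / √(p.ESb P₀ ⟨j, hj⟩) *
      ∑ u ∈ Finset.range (h / p.LSb),
        (p.fSb ⁻¹' p.α ⟨j, hj⟩).indicator (fun _ => (1 : ℝ)) (window p.LSb (p.LSb * u) x)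
  else if (j : ℕ) = p.KSb + 1 then
    (p.σLb P₀)⁻¹ * ∑ u ∈ Finset.range h, p.fLb (window p.mLb u x)
  else
    (p.σSum P₀)⁻¹ * ∑ u ∈ Finset.range h, p.fSum (window p.mSum u x)

end TripleParams

/-- The quadratic statistic `∑_{i} (∑_q d(i,q) T_sum^{[q]})²`. -/
def TQuad {𝔛 : Type*} [MeasurableSpace 𝔛] {Q τ : ℕ} (p : Fin Q → TripleParams 𝔛)
    (d : Fin τ → Fin Q → ℝ) (P₀ : Measure 𝔛) (n : ℕ) (x : ℕ → 𝔛) : ℝ :=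
  ∑ i, (∑ q, d i q * (p q).TSum P₀ n x) ^ 2

/-- `s̲* = h + max_q max(m_sum^{[q]}, m_lb^{[q]}) - 1`. -/
def sMin {𝔛 : Type*} [MeasurableSpace 𝔛] {Q : ℕ} (p : Fin Q → TripleParams 𝔛) (h : ℕ) : ℕ :=
  h + Finset.univ.sup (fun q => max (p q).mSum (p q).mLb) - 1

/-- The index set of the `K* = ∑_q (K_sb^{[q]} + 3)` coordinates of `f*`, `Z*`, `𝒳*`, `η*`:
the pair `(q, j)` is the coordinate number `∑_{r < q} (K_sb^{[r]} + 3) + j`. -/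
abbrev Idx {𝔛 : Type*} [MeasurableSpace 𝔛] {Q : ℕ} (p : Fin Q → TripleParams 𝔛) : Type :=
  Σ q : Fin Q, Fin ((p q).KSb + 3)

/-- The index set `(q, k, j)` of all coordinates of the vectors `𝒴_k^{[q]}` and `ζ_k^{[q]}`. -/
abbrev BlockIdx {𝔛 : Type*} [MeasurableSpace 𝔛] {Q : ℕ} (p : Fin Q → TripleParams 𝔛) : Type :=
  Σ q : Fin Q, Fin (p q).NLb × Fin ((p q).KSb + 3)

section

variable {𝔛 : Type*} [MeasurableSpace 𝔛] {Q : ℕ}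

/-- The coordinates of `f*`. -/
def fStar (p : Fin Q → TripleParams 𝔛) (P₀ : Measure 𝔛) (h : ℕ) (a : Idx p)
    (x : ℕ → 𝔛) : ℝ :=
  (p a.1).coord P₀ h a.2 x

/-- `Z*_i = f*(ε_{h(i-1)+1}, ε_{h(i-1)+2}, …)`, `i ≥ 1`. -/
def ZStar (p : Fin Q → TripleParams 𝔛) (P₀ : Measure 𝔛) (h i : ℕ) (a : Idx p)
    (x : ℕ → 𝔛) : ℝ :=
  fStar p P₀ h a (fun t => x (h * (i - 1) + t))

/-- `Φ* = D_{H₀} Z*₁ + ∑_{2 ≤ i ≤ (s-1)/h+1} (cov_{H₀}(Z*₁, Z*_i) + cov_{H₀}(Z*₁, Z*_i)ᵀ)`. -/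
def PhiStar (p : Fin Q → TripleParams 𝔛) (P₀ : Measure 𝔛) (s h : ℕ) :
    Matrix (Idx p) (Idx p) ℝ :=
  Matrix.of fun a b =>
    cov[ZStar p P₀ h 1 a, ZStar p P₀ h 1 b; iidLaw P₀] +
      ∑ i ∈ Finset.Icc 2 ((s - 1) / h + 1),
        (cov[ZStar p P₀ h 1 a, ZStar p P₀ h i b; iidLaw P₀] +
          cov[ZStar p P₀ h 1 b, ZStar p P₀ h i a; iidLaw P₀])

/-- `𝒳*_{k+1}`, with `L = ⌊n / N⌋`: the normalized sum over all `i` with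
`L k / h ≤ i ≤ (L (k + 1) - s) / h` (such `i` are at most `n`). -/
def XStar (p : Fin Q → TripleParams 𝔛) (P₀ : Measure 𝔛) (N s h n k : ℕ) (a : Idx p)
    (x : ℕ → 𝔛) : ℝ :=
  1 / √(n : ℝ) *
    ∑ i ∈ (Finset.range (n + 1)).filter
        (fun i => n / N * k ≤ h * i ∧ h * i + s ≤ n / N * (k + 1)),
      (fStar p P₀ h a (fun t => x (h * i + t)) - ∫ y, fStar p P₀ h a y ∂(iidLaw P₀))

/-- The linear map that produces all `𝒴_k^{[q]}` from `𝒳*₁, …, 𝒳*_N`, and all `ζ_k^{[q]}` from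
`η*₁, …, η*_N`: the vector number `k` (from zero) of the `q`-th family is the sum of the
`N / N_lb^{[q]}` consecutive vectors numbered `(N / N_lb^{[q]}) k + i`. -/
def blockVec (p : Fin Q → TripleParams 𝔛) (N : ℕ) (v : ℕ → Idx p → ℝ) : BlockIdx p → ℝ :=
  fun b => ∑ i ∈ Finset.range (N / (p b.1).NLb),
    v (N / (p b.1).NLb * (b.2.1 : ℕ) + i) ⟨b.1, b.2.2⟩

/-- All `𝒴_k^{[q]}(j)`, as one vector. -/
def YVec (p : Fin Q → TripleParams 𝔛) (P₀ : Measure 𝔛) (N s h n : ℕ) (x : ℕ → 𝔛) :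
    BlockIdx p → ℝ :=
  blockVec p N (fun k a => XStar p P₀ N s h n k a x)

/-- `∑_k c_k^{[q]}(K_sb^{[q]} + 2)`. -/
def sumForm (p : Fin Q → TripleParams 𝔛) (q : Fin Q) (c : BlockIdx p → ℝ) : ℝ :=
  ∑ k, c ⟨q, k, ⟨(p q).KSb + 2, by omega⟩⟩

/-- `N_lb^{[q]} ∑_k (c_k^{[q]}(K_sb^{[q]} + 1))²`. -/
def lbForm (p : Fin Q → TripleParams 𝔛) (q : Fin Q) (c : BlockIdx p → ℝ) : ℝ :=
  (p q).NLb * ∑ k, c ⟨q, k, ⟨(p q).KSb + 1, by omega⟩⟩ ^ 2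

/-- `L_sb^{[q]} ∑_{j=0}^{K_sb^{[q]}} (∑_k c_k^{[q]}(j))²`. -/
def sbForm (p : Fin Q → TripleParams 𝔛) (q : Fin Q) (c : BlockIdx p → ℝ) : ℝ :=
  (p q).LSb * ∑ j : Fin ((p q).KSb + 1), (∑ k, c ⟨q, k, ⟨j, by omega⟩⟩) ^ 2

/-- `∑_i (∑_q d(i,q) ∑_k c_k^{[q]}(K_sb^{[q]} + 2))²`. -/
def quadForm (p : Fin Q → TripleParams 𝔛) {τ : ℕ} (d : Fin τ → Fin Q → ℝ)
    (c : BlockIdx p → ℝ) : ℝ :=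
  ∑ i, (∑ q, d i q * sumForm p q c) ^ 2

end

/-- `R_n = o_P(1)` for real random variables `R_n`, each on its own probability space. -/
def IsLittleOP {Ω : ℕ → Type*} [∀ n, MeasurableSpace (Ω n)] (μ : ∀ n, Measure (Ω n))
    (R : ∀ n, Ω n → ℝ) : Prop :=
  ∀ δ : ℝ, 0 < δ → Tendsto (fun n => μ n {ω | δ ≤ |R n ω|}) atTop (𝓝 0)

/-- The hypothesis `H₀` for a series scheme: for every `n`, the elements `ε n 0, …, ε n (n-1)` of
the `n`-th series are independent with law `P₀`. (Values `ε n i` with `i ≥ n` play no role.) -/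
def IsH0 {𝔛 : Type*} [MeasurableSpace 𝔛] (P₀ : Measure 𝔛) {Ω : ℕ → Type*}
    [∀ n, MeasurableSpace (Ω n)] (μ : ∀ n, Measure (Ω n)) (ε : ∀ n, ℕ → Ω n → 𝔛) : Prop :=
  ∀ n, iIndepFun (fun i : Fin n => ε n i) (μ n) ∧ ∀ i : Fin n, HasLaw (ε n i) P₀ (μ n)

end JointLimit

end

open JointLimit

/-!
All statistics are, up to negligible errors, continuous functions of normalized sums of functionals
of bounded windows of one i.i.d. sequence, so a central limit theorem for finitely dependent
stationary sequences together with Slutsky's theorem gives everything at once.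

*Central limit theorem.* If `G` depends on finitely many coordinates, has mean zero and finite
variance, the sums of `G` over shifts of the sequence by multiples of `h` are asymptotically normal
(`tendstoInDistribution_shiftSum`). This is Bernstein's method: long blocks separated by gaps are
independent and obey the classical theorem (`tendsto_charFun_bigBlocks`), the sums over the gaps are
independent too and small in `L¹` (`integral_abs_shiftSum_sub_bigBlocks_le`), and an exact recursion
for the variances (`variance_shiftSum_succ`) identifies the limit as the block length tends to
infinity (`tendsto_of_double_approx`). Linear combinations of the coordinates of `f*` have the asymptotic
variances given by the quadratic form of `Φ*` (`limVar_linComb`), which also shows that `Φ*` is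
positive semidefinite. As the vectors `𝒳*₁, …, 𝒳*_N` are functionals of disjoint blocks, they are
independent, and the factorization of characteristic functions and Lévy's theorem give the joint
convergence to `η*₁, …, η*_N` (`tendstoInDistribution_XStar`), hence that of `𝒴` to `ζ`.

*Approximation.* The normalized sums behind the three statistics and the sums of the vectors `𝒳*`
of the matching blocks are sums of the same centred summands over sets of positions whose symmetric
difference is bounded in `n`, so that they differ by `O(1 / √n)` in `L¹`
(`tendstoInMeasure_cellSum_sub`). Thus all statistics are a fixed continuous function `statMap` of
`𝒴` and of a vector of errors which tends in probability to a constant (`eventually_statVec_eq`,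
`tendstoInMeasure_errVec`), and the pair formed by `𝒴` and the statistics converges in distribution
(`tendstoInDistribution_YVec_statVec`).

*Series schemes.* These vectors depend only on the first `n` elements, so their laws are the same
under every scheme which satisfies `H₀` (`hasLaw_of_dependsOn`). The stochastic expansions follow
from the joint convergence, since the difference of a statistic and its approximation is a
continuous function of the converging vector which vanishes on the limit, and convergence in
distribution to zero is convergence in probability (`IsLittleOP.of_tendstoInDistribution`).
-/

open scoped ENNReal

namespace JointLimit

/-! ### Functionals of an i.i.d. sequence -/

section Shift

variable {𝔛 E : Type*}

/-- The sequence `x` without its first `a` elements. -/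
def shift (a : ℕ) (x : ℕ → 𝔛) : ℕ → 𝔛 := fun t => x (a + t)

lemma shift_shift (a b : ℕ) (x : ℕ → 𝔛) : shift a (shift b x) = shift (b + a) x := by
  funext t; simp [shift, add_assoc]

@[simp] lemma shift_zero (x : ℕ → 𝔛) : shift 0 x = x := by funext t; simp [shift]

lemma _root_.DependsOn.shift {F : (ℕ → 𝔛) → E} {s : ℕ} (hF : DependsOn F (Set.Iio s)) (a : ℕ) :
    DependsOn (fun x => F (shift a x)) (Set.Ico a (a + s)) := by
  intro x y hxy
  refine hF fun t ht => hxy _ ?_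
  simp only [Set.mem_Iio] at ht
  simp [ht]

end Shift

section Iid

variable {𝔛 : Type*} [MeasurableSpace 𝔛] {P₀ : Measure 𝔛} [IsProbabilityMeasure P₀]
  {E : Type*} [MeasurableSpace E]

instance : IsProbabilityMeasure (iidLaw P₀) := by unfold iidLaw; infer_instance

@[fun_prop]
lemma measurable_shift (a : ℕ) : Measurable (shift (𝔛 := 𝔛) a) := by
  unfold shift; fun_prop

lemma measurePreserving_shift (a : ℕ) :
    MeasurePreserving (shift a) (iidLaw P₀) (iidLaw P₀) where
  measurable := measurable_shift a
  map_eq := Measure.map_infinitePi_infinitePi_of_inj (P := fun _ : ℕ => P₀) (f := fun t => a + t)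
    (add_right_injective a)

/-- Consecutive blocks of length `c`, starting at position `a`, are independent: the positions in
all blocks are numbered injectively by the pairs `(j, u)`, and an infinite product over pairs is an
iterated infinite product. -/
lemma iIndepFun_blocks (a c : ℕ) :
    iIndepFun (fun (j : ℕ) (x : ℕ → 𝔛) (u : Fin c) => x (a + c * j + u)) (iidLaw P₀) := by
  have hlaw (j : ℕ) : (iidLaw P₀).map (fun (x : ℕ → 𝔛) (u : Fin c) => x (a + c * j + u)) =
      Measure.infinitePi (fun _ : Fin c => P₀) :=
    Measure.map_infinitePi_infinitePi_of_inj (P := fun _ : ℕ => P₀)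
      (f := fun u : Fin c => a + c * j + (u : ℕ)) (fun u v huv => by
        apply Fin.ext; simpa using huv)
  have hinj : Function.Injective (fun b : ℕ × Fin c => a + c * b.1 + (b.2 : ℕ)) := by
    rintro ⟨i, u⟩ ⟨j, v⟩ huv
    have huv : c * i + (u : ℕ) = c * j + (v : ℕ) := by simp only at huv; omega
    have hc : 0 < c := u.pos
    have h1 : i = j := by
      have := congrArg (· / c) huv
      simpa [Nat.mul_add_div hc, Nat.div_eq_of_lt u.2, Nat.div_eq_of_lt v.2] using this
    subst h1
    simp only [Prod.mk.injEq, true_and]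
    apply Fin.ext; omega
  rw [iIndepFun_iff_map_fun_eq_infinitePi_map (by fun_prop)]
  simp_rw [hlaw]
  have h1 := Measure.map_infinitePi_infinitePi_of_inj (P := fun _ : ℕ => P₀) hinj
  have h2 := Measure.infinitePi_map_curry (ι := ℕ) (κ := Fin c) (fun (_ : ℕ) (_ : Fin c) => P₀)
  rw [← h2, ← h1]
  rw [Measure.map_map (by fun_prop) (by fun_prop)]
  rfl

/-- Functionals of disjoint blocks are independent. -/
lemma iIndepFun_of_dependsOn_blocks {F : ℕ → (ℕ → 𝔛) → E} (hF : ∀ j, Measurable (F j)) (a c : ℕ)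
    (hd : ∀ j, DependsOn (F j) (Set.Ico (a + c * j) (a + c * j + c))) :
    iIndepFun F (iidLaw P₀) := by
  obtain ⟨x₀⟩ := P₀.nonempty_of_neZero
  -- the sequence with the values `y` on the block number `j` and a dummy value elsewhere
  let pad (j : ℕ) (y : Fin c → 𝔛) : ℕ → 𝔛 := fun t =>
    if h : t - (a + c * j) < c then y ⟨t - (a + c * j), h⟩ else x₀
  have hpad (j : ℕ) : Measurable (pad j) := by
    refine measurable_pi_lambda _ fun t => ?_
    by_cases h : t - (a + c * j) < c
    · simp only [pad, h, dif_pos]; fun_prop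
    · simp only [pad, h, dif_neg, not_false_eq_true]; fun_prop
  have := (iIndepFun_blocks (P₀ := P₀) a c).comp (fun j y => F j (pad j y))
    (fun j => (hF j).comp (hpad j))
  convert this using 1
  funext j x
  refine hd j fun t ht => ?_
  have h1 : t - (a + c * j) < c := by have := ht.1; have := ht.2; omega
  have h2 : a + c * j + (t - (a + c * j)) = t := by have := ht.1; omega
  simp [pad, h1, h2]

/-- If the elements of `x` are independent with law `P₀`, a functional of the first `n` elements
has the same law as under `iidLaw P₀`, whatever the remaining elements are. -/
lemma hasLaw_of_dependsOn {Ω : Type*} [MeasurableSpace Ω] {μ : Measure Ω}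
    {ε : ℕ → Ω → 𝔛} {n : ℕ} (hi : iIndepFun (fun i : Fin n => ε i) μ)
    (hl : ∀ i : Fin n, HasLaw (ε i) P₀ μ) {F : (ℕ → 𝔛) → E} (hF : Measurable F)
    (hd : DependsOn F (Set.Iio n)) :
    HasLaw (fun ω => F (fun i => ε i ω)) ((iidLaw P₀).map F) μ := by
  obtain ⟨x₀⟩ := P₀.nonempty_of_neZero
  let pad (y : Fin n → 𝔛) : ℕ → 𝔛 := fun t => if h : t < n then y ⟨t, h⟩ else x₀
  have hpad : Measurable pad := by
    refine measurable_pi_lambda _ fun t => ?_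
    by_cases h : t < n
    · simp only [pad, h, dif_pos]; fun_prop
    · simp only [pad, h, dif_neg, not_false_eq_true]; fun_prop
  have hfac (x : ℕ → 𝔛) : F x = F (pad fun i => x i) :=
    hd fun t ht => by simp [pad, Set.mem_Iio.1 ht]
  have h1 := hi.hasLaw_pi hl
  have h2 : (iidLaw P₀).map (fun (x : ℕ → 𝔛) (i : Fin n) => x i) = Measure.pi fun _ => P₀ := by
    rw [← Measure.infinitePi_eq_pi]
    exact Measure.map_infinitePi_infinitePi_of_inj (P := fun _ : ℕ => P₀)
      (f := fun u : Fin n => (u : ℕ)) Fin.val_injective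
  have hm : Measurable fun y => F (pad y) := hF.comp hpad
  constructor
  · rw [show (fun ω => F fun i => ε i ω) = fun ω => (fun y => F (pad y)) (fun i : Fin n => ε i ω)
      from funext fun ω => hfac _]
    exact hm.comp_aemeasurable h1.aemeasurable
  · have e1 : (fun ω => F fun i => ε i ω) = (fun y => F (pad y)) ∘ (fun ω (i : Fin n) => ε i ω) :=
      funext fun ω => hfac _
    have e2 : F = (fun y => F (pad y)) ∘ (fun (x : ℕ → 𝔛) (i : Fin n) => x i) :=
      funext fun ω => hfac _
    rw [e1, ← AEMeasurable.map_map_of_aemeasurable hm.aemeasurable h1.aemeasurable, h1.map_eq,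
      ← h2, Measure.map_map hm (by fun_prop), ← e2]

end Iid

/-! ### Characteristic functions and deterministic rescaling -/

section CharFun

variable {Ω : Type*} [MeasurableSpace Ω] {P : Measure Ω} [IsProbabilityMeasure P]

lemma norm_charFun_map_sub_le {X Y : Ω → ℝ} (hX : Integrable X P) (hY : Integrable Y P) (t : ℝ) :
    ‖charFun (P.map X) t - charFun (P.map Y) t‖ ≤ |t| * ∫ ω, |X ω - Y ω| ∂P := by
  have hi (Z : Ω → ℝ) (hZ : Integrable Z P) :
      Integrable (fun ω => Complex.exp (t * Z ω * Complex.I)) P := by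
    refine Integrable.of_bound (C := 1) ?_ (ae_of_all _ fun ω => ?_)
    · have := hZ.aemeasurable
      exact (by fun_prop : AEMeasurable (fun ω => Complex.exp (t * Z ω * Complex.I)) P)
        |>.aestronglyMeasurable
    · rw [← Complex.ofReal_mul, Complex.norm_exp_ofReal_mul_I]
  rw [charFun_apply_real, charFun_apply_real, integral_map hX.aemeasurable (by fun_prop),
    integral_map hY.aemeasurable (by fun_prop), ← integral_sub (hi X hX) (hi Y hY),
    ← integral_const_mul]
  refine norm_integral_le_of_norm_le ((hX.sub hY).abs.const_mul _) (ae_of_all _ fun ω => ?_)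
  have e : Complex.exp (t * X ω * Complex.I) - Complex.exp (t * Y ω * Complex.I) =
      Complex.exp ((t * Y ω : ℝ) * Complex.I) *
        (Complex.exp (Complex.I * (t * (X ω - Y ω) : ℝ)) - 1) := by
    rw [mul_sub, ← Complex.exp_add]
    push_cast
    ring_nf
  rw [e, norm_mul, Complex.norm_exp_ofReal_mul_I, one_mul]
  refine Real.norm_exp_I_mul_ofReal_sub_one_le.trans ?_
  rw [Real.norm_eq_abs, abs_mul]

lemma integral_abs_le_sqrt_variance {X : Ω → ℝ} (hX : MemLp X 2 P) (h0 : ∫ ω, X ω ∂P = 0) :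
    ∫ ω, |X ω| ∂P ≤ √(Var[X; P]) := by
  refine Real.le_sqrt_of_sq_le ?_
  have h1 := variance_nonneg (fun ω => |X ω|) P
  rw [variance_eq_sub (X := fun ω => |X ω|) hX.abs] at h1
  rw [variance_of_integral_eq_zero hX.aestronglyMeasurable.aemeasurable h0]
  simp only [Pi.pow_apply, sq_abs] at h1
  linarith

/-- Slutsky's theorem for deterministic factors, read off on characteristic functions. -/
lemma tendsto_charFun_of_tendstoInDistribution {Ω' : Type*} [MeasurableSpace Ω'] {P' : Measure Ω'}
    [IsProbabilityMeasure P'] {X : ℕ → Ω → ℝ} {Z : Ω' → ℝ}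
    (h : TendstoInDistribution X atTop Z (fun _ => P) P') {c : ℕ → ℝ} {c₀ : ℝ}
    (hc : Tendsto c atTop (𝓝 c₀)) :
    Tendsto (fun n => charFun (P.map (X n)) (c n)) atTop (𝓝 (charFun (P'.map Z) c₀)) := by
  have h1 : TendstoInMeasure P (fun n _ => c n) atTop (fun _ => c₀) :=
    tendstoInMeasure_of_tendsto_ae (fun n => aestronglyMeasurable_const) (ae_of_all _ fun _ => hc)
  have h2 := h.continuous_comp_prodMk_of_tendstoInMeasure_const
    (g := fun z : ℝ × ℝ => z.2 * z.1) (by fun_prop) h1 (fun n => aemeasurable_const)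
  have h3 := ProbabilityMeasure.tendsto_iff_tendsto_charFun.1 h2.tendsto 1
  simpa [charFun_map_mul_comp (h.forall_aemeasurable _), charFun_map_mul_comp h.aemeasurable_limit]
    using h3

/-- A sequence which is approximated, up to errors with arbitrarily small limits, by sequences with
limits `b p`, where `b p → b₀`, converges to `b₀`. -/
lemma tendsto_of_double_approx {E : Type*} [SeminormedAddCommGroup E] {u : ℕ → E}
    {a : ℕ → ℕ → E} {b : ℕ → E} {b₀ : E} {e : ℕ → ℝ} {d : ℕ → ℕ → ℝ}
    (ha : ∀ p, Tendsto (a p) atTop (𝓝 (b p))) (hb : Tendsto b atTop (𝓝 b₀))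
    (he : Tendsto e atTop (𝓝 0)) (hd : ∀ p, Tendsto (d p) atTop (𝓝 0))
    (hu : ∀ p n, ‖u n - a p n‖ ≤ e p + d p n) : Tendsto u atTop (𝓝 b₀) := by
  rw [Metric.tendsto_nhds]
  intro δ hδ
  obtain ⟨p, hp1, hp2⟩ := ((Metric.tendsto_nhds.1 hb (δ / 4) (by positivity)).and
    (he.eventually_lt_const (show (0 : ℝ) < δ / 4 by positivity))).exists
  filter_upwards [Metric.tendsto_nhds.1 (ha p) (δ / 4) (by positivity),
    (hd p).eventually_lt_const (show (0 : ℝ) < δ / 4 by positivity)] with n h1 h2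
  have h3 := hu p n
  rw [← dist_eq_norm] at h3
  linarith [dist_triangle (u n) (a p n) b₀, dist_triangle (a p n) (b p) b₀]

lemma tendsto_div_of_abs_sub_le {a : ℕ → ℝ} {c D : ℝ} (ha : ∀ᶠ n : ℕ in atTop, |a n - c * n| ≤ D) :
    Tendsto (fun n : ℕ => a n / n) atTop (𝓝 c) := by
  have h1 : Tendsto (fun n : ℕ => D / (n : ℝ)) atTop (𝓝 0) :=
    tendsto_natCast_atTop_atTop.const_div_atTop _
  rw [tendsto_iff_norm_sub_tendsto_zero]
  refine squeeze_zero' (Eventually.of_forall fun _ => norm_nonneg _) ?_ h1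
  filter_upwards [ha, eventually_gt_atTop 0] with n hn h0
  have h0' : (0 : ℝ) < n := by exact_mod_cast h0
  rw [Real.norm_eq_abs, show a n / n - c = (a n - c * n) / n by field_simp, abs_div,
    abs_of_pos h0']
  gcongr

lemma abs_natCast_div_sub_le {N : ℕ} (hN : 0 < N) (n : ℕ) :
    |((n / N : ℕ) : ℝ) - (1 / N : ℝ) * n| ≤ 1 := by
  have hN' : (0 : ℝ) < N := by exact_mod_cast hN
  have h1 : ((n / N : ℕ) : ℝ) ≤ n / N := Nat.cast_div_le
  have h2 : (n : ℝ) / N < (n / N : ℕ) + 1 := by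
    rw [div_lt_iff₀ hN']
    exact_mod_cast (Nat.lt_mul_of_div_lt (Nat.lt_succ_self _) hN)
  rw [one_div_mul_eq_div, abs_le]
  constructor <;> linarith

lemma tendsto_natDiv_div {N : ℕ} (hN : 0 < N) :
    Tendsto (fun n : ℕ => ((n / N : ℕ) : ℝ) / n) atTop (𝓝 (1 / N)) :=
  tendsto_div_of_abs_sub_le (Eventually.of_forall (abs_natCast_div_sub_le hN))

/-- If `X m / √m` is asymptotically `𝒩(0, v)` and `ℓ n ~ c n`, then `X (ℓ n) / √n` is
asymptotically `𝒩(0, v c)`, in terms of characteristic functions. -/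
lemma tendsto_charFun_inv_sqrt_mul_comp {X : ℕ → Ω → ℝ} {v c : ℝ} {ℓ : ℕ → ℕ}
    (hX : ∀ m, AEMeasurable (X m) P) (hv : 0 ≤ v) (hc : 0 ≤ c)
    (h : TendstoInDistribution (fun (m : ℕ) ω => (√(m : ℝ))⁻¹ * X m ω) atTop id (fun _ => P)
      (gaussianReal 0 v.toNNReal))
    (hℓ : Tendsto ℓ atTop atTop) (hℓc : Tendsto (fun n : ℕ => (ℓ n : ℝ) / n) atTop (𝓝 c))
    (t : ℝ) :
    Tendsto (fun n : ℕ => charFun (P.map fun ω => (√(n : ℝ))⁻¹ * X (ℓ n) ω) t) atTop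
      (𝓝 (Complex.exp (-(v * c * t ^ 2 / 2 : ℝ)))) := by
  have h' : TendstoInDistribution (fun n ω => (√(ℓ n : ℝ))⁻¹ * X (ℓ n) ω) atTop id
      (fun _ => P) (gaussianReal 0 v.toNNReal) :=
    ⟨fun n => h.forall_aemeasurable _, h.aemeasurable_limit, h.tendsto.comp hℓ⟩
  have h1 := tendsto_charFun_of_tendstoInDistribution h' ((hℓc.sqrt).mul_const t)
  rw [Measure.map_id, charFun_gaussianReal] at h1
  have e : Complex.exp (-(v * c * t ^ 2 / 2 : ℝ)) =
      Complex.exp ((√c * t : ℝ) * (0 : ℝ) * Complex.I -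
        (v.toNNReal : ℝ) * (√c * t : ℝ) ^ 2 / 2) := by
    rw [Real.coe_toNNReal _ hv, ← Complex.ofReal_pow, mul_pow, Real.sq_sqrt hc]
    push_cast
    congr 1
    ring
  rw [e]
  refine h1.congr' ?_
  filter_upwards [hℓ.eventually_gt_atTop 0] with n hn
  have hn' : (0 : ℝ) < ℓ n := by exact_mod_cast hn
  rw [charFun_map_mul_comp (hX _), charFun_map_mul_comp (hX _)]
  congr 1
  rw [Real.sqrt_div hn'.le]
  have := Real.sqrt_pos.2 hn'
  field_simp

end CharFun

/-! ### Central limit theorem for finitely dependent stationary sequences -/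

section CLT

variable {𝔛 : Type*} [MeasurableSpace 𝔛] {P₀ : Measure 𝔛} [IsProbabilityMeasure P₀]

/-- The sum of `G` over the first `n` of the sequences `x`, `shift h x`, `shift (2h) x`, …; if `G`
depends on finitely many coordinates, the summands are stationary and `m`-dependent. -/
def shiftSum (G : (ℕ → 𝔛) → ℝ) (h n : ℕ) (x : ℕ → 𝔛) : ℝ :=
  ∑ i ∈ Finset.range n, G (shift (h * i) x)

/-- The asymptotic variance of `shiftSum G h n / √n`, if the summands at distances `≥ r` are
uncorrelated. -/
noncomputable def limVar (P₀ : Measure 𝔛) (G : (ℕ → 𝔛) → ℝ) (h r : ℕ) : ℝ :=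
  Var[G; iidLaw P₀] + 2 * ∑ i ∈ Finset.Ico 1 r, cov[G, fun x => G (shift (h * i) x); iidLaw P₀]

variable {G : (ℕ → 𝔛) → ℝ} {h s r : ℕ}

omit [MeasurableSpace 𝔛] in
lemma shiftSum_add (G : (ℕ → 𝔛) → ℝ) (h a n : ℕ) (x : ℕ → 𝔛) :
    shiftSum G h (a + n) x = shiftSum G h a x + shiftSum G h n (shift (h * a) x) := by
  simp [shiftSum, Finset.sum_range_add, shift_shift, mul_add]

omit [MeasurableSpace 𝔛] in
lemma shiftSum_mul (G : (ℕ → 𝔛) → ℝ) (h q K : ℕ) (x : ℕ → 𝔛) :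
    shiftSum G h (q * K) x = ∑ j ∈ Finset.range K, shiftSum G h q (shift (h * q * j) x) := by
  induction K with
  | zero => simp [shiftSum]
  | succ K ih => rw [Finset.sum_range_succ, ← ih, mul_add_one, shiftSum_add, mul_assoc]

lemma measurable_shiftSum (hG : Measurable G) (h n : ℕ) : Measurable (shiftSum G h n) := by
  unfold shiftSum; fun_prop

lemma memLp_comp_shift (hG : MemLp G 2 (iidLaw P₀)) (a : ℕ) :
    MemLp (fun x => G (shift a x)) 2 (iidLaw P₀) :=
  hG.comp_measurePreserving (measurePreserving_shift a)

lemma integral_comp_shift (hG : Measurable G) (a : ℕ) :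
    ∫ x, G (shift a x) ∂(iidLaw P₀) = ∫ x, G x ∂(iidLaw P₀) := by
  rw [← integral_map (φ := shift a) (by fun_prop) hG.aestronglyMeasurable,
    (measurePreserving_shift a).map_eq]

lemma map_comp_shift (hG : Measurable G) (a : ℕ) :
    (iidLaw P₀).map (fun x => G (shift a x)) = (iidLaw P₀).map G := by
  rw [← Function.comp_def, ← Measure.map_map hG (by fun_prop), (measurePreserving_shift a).map_eq]

lemma variance_comp_shift (hG : Measurable G) (a : ℕ) :
    Var[fun x => G (shift a x); iidLaw P₀] = Var[G; iidLaw P₀] :=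
  (measurePreserving_shift a).variance_fun_comp hG.aemeasurable

lemma memLp_shiftSum (hG : MemLp G 2 (iidLaw P₀)) (h n : ℕ) :
    MemLp (shiftSum G h n) 2 (iidLaw P₀) :=
  memLp_finsetSum _ fun _ _ => memLp_comp_shift hG _

lemma integral_shiftSum (hG : Measurable G) (hG2 : MemLp G 2 (iidLaw P₀))
    (h0 : ∫ x, G x ∂(iidLaw P₀) = 0) (h n : ℕ) :
    ∫ x, shiftSum G h n x ∂(iidLaw P₀) = 0 := by
  unfold shiftSum
  rw [integral_finsetSum _ fun i _ => (memLp_comp_shift hG2 _).integrable (by norm_num)]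
  simp [integral_comp_shift hG, h0]

lemma integral_abs_shiftSum_le (hG : Measurable G) (hG2 : MemLp G 2 (iidLaw P₀)) (h n : ℕ) :
    ∫ x, |shiftSum G h n x| ∂(iidLaw P₀) ≤ n * ∫ x, |G x| ∂(iidLaw P₀) := by
  have hi (i : ℕ) : Integrable (fun x => |G (shift (h * i) x)|) (iidLaw P₀) :=
    ((memLp_comp_shift hG2 _).integrable (by norm_num)).abs
  calc ∫ x, |shiftSum G h n x| ∂(iidLaw P₀)
      ≤ ∫ x, ∑ i ∈ Finset.range n, |G (shift (h * i) x)| ∂(iidLaw P₀) :=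
        integral_mono ((memLp_shiftSum hG2 h n).integrable (by norm_num)).abs
          (integrable_finsetSum _ fun i _ => hi i) fun x => Finset.abs_sum_le_sum_abs _ _
    _ = n * ∫ x, |G x| ∂(iidLaw P₀) := by
        rw [integral_finsetSum _ fun i _ => hi i]
        simp [integral_comp_shift (G := fun x => |G x|) (by fun_prop)]

omit [MeasurableSpace 𝔛] in
lemma dependsOn_shiftSum (hd : DependsOn G (Set.Iio s)) (hs : s ≤ h * r) (n : ℕ) :
    DependsOn (shiftSum G h n) (Set.Iio (h * (n + r))) := by
  intro x y hxy
  refine Finset.sum_congr rfl fun i hi => _root_.DependsOn.shift hd (h * i) fun t ht => hxy t ?_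
  have h1 : h * i ≤ h * n := Nat.mul_le_mul_left _ (Finset.mem_range.1 hi).le
  have := ht.2
  simp only [Set.mem_Iio, mul_add]
  omega

lemma covariance_shift_eq_zero (hG : Measurable G) (hG2 : MemLp G 2 (iidLaw P₀))
    (hd : DependsOn G (Set.Iio s)) {a : ℕ} (ha : s ≤ a) :
    cov[G, fun x => G (shift a x); iidLaw P₀] = 0 := by
  have hi : iIndepFun (fun (j : ℕ) x => G (shift (a * j) x)) (iidLaw P₀) := by
    -- block number `j` of length `a` contains the coordinates of the functional shifted by `a j`
    refine iIndepFun_of_dependsOn_blocks (fun j => by fun_prop) 0 a fun j => ?_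
    refine (hd.shift (a * j)).mono fun t ht => ?_
    have := ht.1; have := ht.2
    simp only [Set.mem_Ico]; omega
  have h01 := hi.indepFun (show (0 : ℕ) ≠ 1 by norm_num)
  simp only [mul_zero, shift_zero, mul_one] at h01
  exact h01.covariance_eq_zero hG2 (memLp_comp_shift hG2 a)

/-- As covariances vanish at lags `≥ r`, adding one summand to a sum of at least `r - 1` summands
increases the variance by exactly `limVar`. -/
lemma variance_shiftSum_succ (hG : Measurable G) (hG2 : MemLp G 2 (iidLaw P₀))
    (hd : DependsOn G (Set.Iio s)) (hs : s ≤ h * r) {n : ℕ} (hn : r ≤ n + 1) :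
    Var[shiftSum G h (n + 1); iidLaw P₀] = Var[shiftSum G h n; iidLaw P₀] + limVar P₀ G h r := by
  -- splitting off the first summand makes the covariance a sum over the lags `1, …, n`
  have e : shiftSum G h (n + 1) = fun x => G x + shiftSum G h n (shift h x) := by
    funext x
    rw [add_comm n 1, shiftSum_add]
    simp [shiftSum]
  have hS := (memLp_shiftSum hG2 h n).comp_measurePreserving (measurePreserving_shift (P₀ := P₀) h)
  rw [Function.comp_def] at hS
  rw [e, variance_fun_add hG2 hS,
    variance_comp_shift (measurable_shiftSum hG h n), limVar]
  have hc : cov[G, fun x => shiftSum G h n (shift h x); iidLaw P₀] =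
      ∑ i ∈ Finset.Ico 1 (n + 1), cov[G, fun x => G (shift (h * i) x); iidLaw P₀] := by
    rw [Finset.sum_Ico_eq_sum_range]
    simp only [shiftSum, shift_shift]
    rw [covariance_fun_sum_right' (fun i _ => memLp_comp_shift hG2 _) hG2]
    exact Finset.sum_congr (by simp) fun i _ => by rw [mul_add, mul_one]
  have hc' : ∑ i ∈ Finset.Ico 1 (n + 1), cov[G, fun x => G (shift (h * i) x); iidLaw P₀] =
      ∑ i ∈ Finset.Ico 1 r, cov[G, fun x => G (shift (h * i) x); iidLaw P₀] := by
    symm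
    refine Finset.sum_subset (Finset.Ico_subset_Ico_right hn) fun i hi hi' => ?_
    refine covariance_shift_eq_zero hG hG2 hd (hs.trans (Nat.mul_le_mul_left _ ?_))
    simp only [Finset.mem_Ico] at hi hi'
    omega
  rw [hc, hc']
  ring

lemma variance_shiftSum_add (hG : Measurable G) (hG2 : MemLp G 2 (iidLaw P₀))
    (hd : DependsOn G (Set.Iio s)) (hs : s ≤ h * r) (k : ℕ) :
    Var[shiftSum G h (r + k); iidLaw P₀] =
      Var[shiftSum G h r; iidLaw P₀] + k * limVar P₀ G h r := by
  induction k with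
  | zero => simp
  | succ k ih =>
    rw [← add_assoc, variance_shiftSum_succ hG hG2 hd hs (by omega), ih]
    push_cast
    ring

lemma tendsto_variance_shiftSum_div (hG : Measurable G) (hG2 : MemLp G 2 (iidLaw P₀))
    (hd : DependsOn G (Set.Iio s)) (hs : s ≤ h * r) :
    Tendsto (fun k : ℕ => Var[shiftSum G h (r + k); iidLaw P₀] / ((r + k + r : ℕ) : ℝ)) atTop
      (𝓝 (limVar P₀ G h r)) := by
  have h1 : Tendsto (fun k : ℕ => ((r + k + r : ℕ) : ℝ)) atTop atTop :=
    tendsto_natCast_atTop_atTop.comp (tendsto_atTop_mono (fun k => by simp; omega) tendsto_id)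
  have h2 : Tendsto (fun k : ℕ => limVar P₀ G h r +
      (Var[shiftSum G h r; iidLaw P₀] - 2 * r * limVar P₀ G h r) / ((r + k + r : ℕ) : ℝ))
      atTop (𝓝 (limVar P₀ G h r + 0)) := tendsto_const_nhds.add (h1.const_div_atTop _)
  rw [add_zero] at h2
  refine h2.congr' ?_
  filter_upwards [eventually_gt_atTop 0] with k hk
  rw [variance_shiftSum_add hG hG2 hd hs]
  have : ((r + k + r : ℕ) : ℝ) ≠ 0 := by positivity
  field_simp
  push_cast
  ring

/-- `limVar` is a limit of normalized variances. -/
lemma limVar_nonneg (hG : Measurable G) (hG2 : MemLp G 2 (iidLaw P₀))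
    (hd : DependsOn G (Set.Iio s)) (hs : s ≤ h * r) : 0 ≤ limVar P₀ G h r :=
  ge_of_tendsto' (tendsto_variance_shiftSum_div hG hG2 hd hs) fun _ =>
    div_nonneg (variance_nonneg _ _) (by positivity)

/-- The sums of the big blocks in Bernstein's decomposition: for a fixed block length, they obey the
classical central limit theorem. -/
lemma tendsto_charFun_bigBlocks (hG : Measurable G) (hG2 : MemLp G 2 (iidLaw P₀))
    (h0 : ∫ x, G x ∂(iidLaw P₀) = 0) (hd : DependsOn G (Set.Iio s)) (hs : s ≤ h * r)
    {p q : ℕ} (hq : p + r = q) (hq0 : 0 < q) (t : ℝ) :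
    Tendsto (fun n : ℕ => charFun ((iidLaw P₀).map fun x =>
        (√(n : ℝ))⁻¹ * ∑ j ∈ Finset.range (n / q), shiftSum G h p (shift (h * q * j) x)) t) atTop
      (𝓝 (Complex.exp (-(Var[shiftSum G h p; iidLaw P₀] / q * t ^ 2 / 2 : ℝ)))) := by
  have hSm := measurable_shiftSum hG h p
  let X : ℕ → (ℕ → 𝔛) → ℝ := fun j x => shiftSum G h p (shift (h * q * j) x)
  have hXm (j : ℕ) : Measurable (X j) := hSm.comp (measurable_shift _)
  have hX0 : X 0 = shiftSum G h p := by funext x; simp [X]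
  have hmean : ∫ x, X 0 x ∂(iidLaw P₀) = 0 := by rw [hX0]; exact integral_shiftSum hG hG2 h0 h p
  have hind : iIndepFun X (iidLaw P₀) := by
    refine iIndepFun_of_dependsOn_blocks hXm 0 (h * q) fun j => ?_
    have := (dependsOn_shiftSum hd hs p).shift (h * q * j)
    rw [hq] at this
    simpa only [zero_add] using this
  have hid (j : ℕ) : IdentDistrib (X j) (X 0) (iidLaw P₀) (iidLaw P₀) :=
    ⟨(hXm j).aemeasurable, (hXm 0).aemeasurable, by rw [hX0]; exact map_comp_shift hSm _⟩
  have hclt := tendstoInDistribution_inv_sqrt_mul_sum_sub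
    (Y := id) (P' := gaussianReal 0 Var[X 0; iidLaw P₀].toNNReal) HasLaw.id
    (by rw [hX0]; exact memLp_shiftSum hG2 h p) hind hid
  simp only [hmean, mul_zero, sub_zero] at hclt
  have hK : Tendsto (fun n : ℕ => n / q) atTop atTop := Nat.tendsto_div_const_atTop hq0.ne'
  have h1 := tendsto_charFun_inv_sqrt_mul_comp (fun n => (by fun_prop : AEMeasurable
    (fun x => ∑ j ∈ Finset.range n, X j x) (iidLaw P₀))) (variance_nonneg _ _)
    (by positivity) hclt hK (tendsto_natDiv_div hq0) t
  simpa only [hX0, mul_one_div] using h1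

/-- The small blocks and the incomplete last block contribute little: the former are independent,
so that the standard deviation of their sum grows as the square root of their number, and the
latter has fewer than `q` summands. -/
lemma integral_abs_shiftSum_sub_bigBlocks_le (hG : Measurable G) (hG2 : MemLp G 2 (iidLaw P₀))
    (h0 : ∫ x, G x ∂(iidLaw P₀) = 0) (hd : DependsOn G (Set.Iio s)) (hs : s ≤ h * r)
    {p q : ℕ} (hq : p + r = q) (hrp : r ≤ p) (hq0 : 0 < q) (n : ℕ) :
    ∫ x, |shiftSum G h n x - ∑ j ∈ Finset.range (n / q), shiftSum G h p (shift (h * q * j) x)|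
        ∂(iidLaw P₀) ≤
      √((n / q : ℕ) * Var[shiftSum G h r; iidLaw P₀]) + q * ∫ x, |G x| ∂(iidLaw P₀) := by
  have hSr := measurable_shiftSum hG h r
  -- the sums over the small blocks, which have `r ≤ p` summands
  let C : ℕ → (ℕ → 𝔛) → ℝ := fun j x => shiftSum G h r (shift (h * p + h * q * j) x)
  have hCm (j : ℕ) : Measurable (C j) := hSr.comp (measurable_shift _)
  have hC2 (j : ℕ) : MemLp (C j) 2 (iidLaw P₀) := memLp_comp_shift (memLp_shiftSum hG2 h r) _
  have hCind : iIndepFun C (iidLaw P₀) := by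
    refine iIndepFun_of_dependsOn_blocks hCm (h * p) (h * q) fun j => ?_
    refine ((dependsOn_shiftSum hd hs r).shift (h * p + h * q * j)).mono
      (Set.Ico_subset_Ico_right ?_)
    gcongr
    omega
  have hCvar : Var[fun x => ∑ j ∈ Finset.range (n / q), C j x; iidLaw P₀] =
      (n / q : ℕ) * Var[shiftSum G h r; iidLaw P₀] := by
    have := IndepFun.variance_sum (s := Finset.range (n / q)) (fun j _ => hC2 j)
      (fun i _ j _ hij => hCind.indepFun hij)
    rw [show (fun x => ∑ j ∈ Finset.range (n / q), C j x) = ∑ j ∈ Finset.range (n / q), C j by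
      funext x; simp, this, Finset.sum_congr rfl fun j _ => variance_comp_shift hSr _]
    simp
  -- the sum over the incomplete last block
  let D : (ℕ → 𝔛) → ℝ := fun x => shiftSum G h (n % q) (shift (h * (q * (n / q))) x)
  have hD1 : ∫ x, |D x| ∂(iidLaw P₀) ≤ q * ∫ x, |G x| ∂(iidLaw P₀) := by
    have h1 := integral_comp_shift (P₀ := P₀) (G := fun x => |shiftSum G h (n % q) x|)
      (measurable_shiftSum hG h _).abs (h * (q * (n / q)))
    have h2 : 0 ≤ ∫ x, |G x| ∂(iidLaw P₀) := integral_nonneg fun _ => abs_nonneg _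
    refine (h1.trans_le (integral_abs_shiftSum_le hG hG2 h _)).trans ?_
    gcongr
    exact (Nat.mod_lt _ hq0).le
  have hCs2 : MemLp (fun x => ∑ j ∈ Finset.range (n / q), C j x) 2 (iidLaw P₀) :=
    memLp_finsetSum _ fun j _ => hC2 j
  have hCs1 := integral_abs_le_sqrt_variance hCs2 (by
    rw [integral_finsetSum _ fun j _ => (hC2 j).integrable (by norm_num)]
    refine Finset.sum_eq_zero fun j _ => ?_
    exact (integral_comp_shift hSr _).trans (integral_shiftSum hG hG2 h0 h r))
  rw [hCvar] at hCs1
  have hDi : Integrable D (iidLaw P₀) :=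
    (memLp_comp_shift (memLp_shiftSum hG2 h _) _).integrable (by norm_num)
  have hCsi := hCs2.integrable (by norm_num)
  have key (x : ℕ → 𝔛) :
      shiftSum G h n x - ∑ j ∈ Finset.range (n / q), shiftSum G h p (shift (h * q * j) x) =
        ∑ j ∈ Finset.range (n / q), C j x + D x := by
    have e1 : shiftSum G h n x = shiftSum G h (q * (n / q)) x + D x := by
      rw [← shiftSum_add, Nat.div_add_mod]
    have e2 (j : ℕ) : shiftSum G h q (shift (h * q * j) x) =
        shiftSum G h p (shift (h * q * j) x) + C j x := by
      simp only [C]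
      rw [← hq, shiftSum_add, shift_shift, add_comm (h * p)]
    rw [e1, shiftSum_mul]
    simp only [e2, Finset.sum_add_distrib]
    ring
  simp_rw [key]
  calc _ ≤ ∫ x, (|∑ j ∈ Finset.range (n / q), C j x| + |D x|) ∂(iidLaw P₀) :=
        integral_mono (hCsi.add hDi).abs (hCsi.abs.add hDi.abs) fun x => abs_add_le _ _
    _ ≤ _ := by
        rw [integral_add hCsi.abs hDi.abs]
        exact add_le_add hCs1 hD1

/-- **Central limit theorem** for the stationary, finitely dependent sequence obtained by applying
a functional of finitely many coordinates to the shifts of an i.i.d. sequence. -/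
theorem tendstoInDistribution_shiftSum (hG : Measurable G) (hG2 : MemLp G 2 (iidLaw P₀))
    (h0 : ∫ x, G x ∂(iidLaw P₀) = 0) (hd : DependsOn G (Set.Iio s)) (hs : s ≤ h * r)
    (hr : 0 < r) :
    TendstoInDistribution (fun (n : ℕ) x => (√(n : ℝ))⁻¹ * shiftSum G h n x) atTop id
      (fun _ => iidLaw P₀) (gaussianReal 0 (limVar P₀ G h r).toNNReal) := by
  have hSm (n : ℕ) := measurable_shiftSum hG h n
  refine ⟨fun n => ((hSm n).const_mul _).aemeasurable, aemeasurable_id, ?_⟩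
  refine ProbabilityMeasure.tendsto_iff_tendsto_charFun.2 fun t => ?_
  simp only [ProbabilityMeasure.coe_mk, Measure.map_id, charFun_gaussianReal]
  have hv := limVar_nonneg hG hG2 hd hs
  -- big blocks of `r + k` summands, gaps of `r` summands, `k → ∞` after `n → ∞`
  have hden : Tendsto (fun k : ℕ => ((r + k + r : ℕ) : ℝ)) atTop atTop :=
    tendsto_natCast_atTop_atTop.comp (tendsto_atTop_mono (fun k => by simp; omega) tendsto_id)
  refine tendsto_of_double_approx
    (e := fun k => |t| * √(Var[shiftSum G h r; iidLaw P₀] / ((r + k + r : ℕ) : ℝ)))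
    (d := fun k n => (|t| * (((r + k + r : ℕ) : ℝ) * ∫ x, |G x| ∂(iidLaw P₀))) / √(n : ℝ))
    (fun k => tendsto_charFun_bigBlocks hG hG2 h0 hd hs (p := r + k) rfl (by omega) t)
    ?_ ?_ ?_ ?_
  · have h1 := tendsto_variance_shiftSum_div hG hG2 hd hs
    have h2 := ((h1.mul_const (t ^ 2)).div_const 2).neg
    have h3 := (Complex.continuous_exp.comp Complex.continuous_ofReal).continuousAt.tendsto.comp h2
    convert h3 using 2
    · simp
    · simp only [Function.comp_apply, Real.coe_toNNReal _ hv]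
      congr 1
      push_cast
      ring
  · have h1 := ((hden.const_div_atTop Var[shiftSum G h r; iidLaw P₀]).sqrt).const_mul |t|
    simpa using h1
  · intro k
    exact (Real.tendsto_sqrt_atTop.comp tendsto_natCast_atTop_atTop).const_div_atTop _
  · intro k n
    set q := r + k + r with hq
    have hq0 : 0 < q := by omega
    let B : (ℕ → 𝔛) → ℝ := fun x =>
      ∑ j ∈ Finset.range (n / q), shiftSum G h (r + k) (shift (h * q * j) x)
    have hB : Integrable B (iidLaw P₀) := integrable_finsetSum _ fun j _ =>
      (memLp_comp_shift (memLp_shiftSum hG2 h _) _).integrable (by norm_num)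
    have hS := (memLp_shiftSum hG2 h n).integrable (μ := iidLaw P₀) (by norm_num)
    refine (norm_charFun_map_sub_le (hS.const_mul _) (hB.const_mul _) t).trans ?_
    simp_rw [← mul_sub, abs_mul]
    rw [integral_const_mul]
    have h1 := integral_abs_shiftSum_sub_bigBlocks_le hG hG2 h0 hd hs (p := r + k) hq.symm
      (by omega) hq0 n
    rcases Nat.eq_zero_or_pos n with rfl | hn
    · simp only [CharP.cast_eq_zero, Real.sqrt_zero, inv_zero, abs_zero, zero_mul, mul_zero,
        div_zero, add_zero]
      positivity
    have hn' : (0 : ℝ) < n := by exact_mod_cast hn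
    have hsn := Real.sqrt_pos.2 hn'
    rw [abs_of_pos (inv_pos.2 hsn)]
    have hVr := variance_nonneg (shiftSum G h r) (iidLaw P₀)
    have h2 : √(((n / q : ℕ) : ℝ) * Var[shiftSum G h r; iidLaw P₀]) ≤
        √(n : ℝ) * √(Var[shiftSum G h r; iidLaw P₀] / q) := by
      rw [← Real.sqrt_mul hn'.le]
      refine Real.sqrt_le_sqrt ?_
      rw [← mul_div_assoc, mul_div_right_comm]
      gcongr
      exact Nat.cast_div_le
    calc |t| * ((√(n : ℝ))⁻¹ * _)
        ≤ |t| * ((√(n : ℝ))⁻¹ * (√(n : ℝ) * √(Var[shiftSum G h r; iidLaw P₀] / q) +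
          q * ∫ x, |G x| ∂(iidLaw P₀))) := by
          gcongr
          exact h1.trans (by gcongr)
      _ = _ := by field_simp

end CLT

/-! ### The coordinates of `f*` as sums of centred summands -/

section Coordinates

variable {𝔛 : Type*} [MeasurableSpace 𝔛] {P₀ : Measure 𝔛}

omit [MeasurableSpace 𝔛] in
lemma window_shift (m i a : ℕ) (x : ℕ → 𝔛) : window m i (shift a x) = window m (a + i) x := by
  funext u; simp [window, shift, add_assoc]

@[fun_prop]
lemma measurable_window (m i : ℕ) : Measurable (window (𝔛 := 𝔛) m i) := by
  unfold window; fun_prop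

omit [MeasurableSpace 𝔛] in
lemma window_congr {m i n : ℕ} (hi : i + m ≤ n) {x y : ℕ → 𝔛} (hxy : ∀ t ∈ Set.Iio n, x t = y t) :
    window m i x = window m i y := by
  funext u
  exact hxy _ (by simp only [Set.mem_Iio]; omega)

lemma sum_range_mul_ite_dvd {M : Type*} [AddCommMonoid M] {L : ℕ} (hL : 0 < L) (n : ℕ)
    (F : ℕ → M) :
    ∑ u ∈ Finset.range (L * n), (if L ∣ u then F u else 0) = ∑ v ∈ Finset.range n, F (L * v) := by
  induction n with
  | zero => simp
  | succ n ih =>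
    rw [mul_add_one, Finset.sum_range_add, ih, Finset.sum_range_succ]
    congr 1
    rw [Finset.sum_eq_single_of_mem 0 (by simpa using hL)]
    · simp
    · intro u hu hu0
      rw [if_neg]
      rw [Nat.dvd_add_right (dvd_mul_right _ _)]
      exact Nat.not_dvd_of_pos_of_lt (Nat.pos_of_ne_zero hu0) (Finset.mem_range.1 hu)

namespace TripleParams

variable (p : TripleParams 𝔛)

/-- The centred summand at position `i` of the sums which define the coordinate number `j`. The
summand of a short-block coordinate is put at the first position of the block and is zero at the
positions which are not multiples of `L_sb`. -/
noncomputable def cell (P₀ : Measure 𝔛) (j : Fin (p.KSb + 3)) (i : ℕ) (x : ℕ → 𝔛) : ℝ :=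
  if hj : (j : ℕ) < p.KSb + 1 then
    if p.LSb ∣ i then
      (p.fSb ⁻¹' p.α ⟨j, hj⟩).indicator (fun _ => (1 : ℝ)) (window p.LSb i x) - p.ESb P₀ ⟨j, hj⟩
    else 0
  else if (j : ℕ) = p.KSb + 1 then p.fLb (window p.mLb i x) - meanH0 P₀ p.fLb
  else p.fSum (window p.mSum i x) - meanH0 P₀ p.fSum

/-- The normalizing factor of the coordinate number `j`. -/
noncomputable def scale (P₀ : Measure 𝔛) (j : Fin (p.KSb + 3)) : ℝ :=
  if hj : (j : ℕ) < p.KSb + 1 then 1 / √(p.ESb P₀ ⟨j, hj⟩)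
  else if (j : ℕ) = p.KSb + 1 then (p.σLb P₀)⁻¹
  else (p.σSum P₀)⁻¹

variable {p}

lemma measurable_cell (j : Fin (p.KSb + 3)) (i : ℕ) : Measurable (p.cell P₀ j i) := by
  unfold cell
  have h1 := p.measurable_fSum
  have h2 := p.measurable_fLb
  split_ifs with hj hi hj'
  · exact ((measurable_const.indicator (p.measurableSet_preimage _)).comp
      (measurable_window _ _)).sub_const _
  · fun_prop
  · fun_prop
  · fun_prop

lemma cell_shift {a : ℕ} (ha : p.LSb ∣ a) (j : Fin (p.KSb + 3)) (i : ℕ) (x : ℕ → 𝔛) :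
    p.cell P₀ j i (shift a x) = p.cell P₀ j (a + i) x := by
  simp only [cell, window_shift, Nat.dvd_add_right ha]

/-- At any position, the summand is zero or distributed as the summand at the position `0`. -/
lemma cell_eq_zero_or_shift (j : Fin (p.KSb + 3)) (i : ℕ) :
    (p.cell P₀ j i = fun _ => 0) ∨ p.cell P₀ j i = fun x => p.cell P₀ j 0 (shift i x) := by
  by_cases hj : (j : ℕ) < p.KSb + 1
  · by_cases hi : p.LSb ∣ i
    · right; funext x; simp [cell, hj, hi, window_shift]
    · left; funext x; simp [cell, hj, hi]
  · right; funext x; simp [cell, hj, window_shift]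

variable [IsProbabilityMeasure P₀]

lemma memLp_cell_zero (hp : p.WellDefined P₀) (j : Fin (p.KSb + 3)) :
    MemLp (p.cell P₀ j 0) 2 (iidLaw P₀) := by
  unfold cell
  split_ifs with hj hi hj'
  · refine MemLp.sub ?_ (memLp_const _)
    refine MemLp.of_bound (C := 1) ?_ (ae_of_all _ fun x => ?_)
    · exact ((measurable_const.indicator (p.measurableSet_preimage _)).comp
        (measurable_window _ _)).aestronglyMeasurable
    · by_cases hx : window p.LSb 0 x ∈ p.fSb ⁻¹' p.α ⟨j, hj⟩ <;> simp [hx]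
  · simp
  · exact hp.memLp_lb.sub (memLp_const _)
  · exact hp.memLp_sum.sub (memLp_const _)

lemma memLp_cell (hp : p.WellDefined P₀) (j : Fin (p.KSb + 3)) (i : ℕ) :
    MemLp (p.cell P₀ j i) 2 (iidLaw P₀) := by
  rcases cell_eq_zero_or_shift (P₀ := P₀) j i with h | h
  · rw [h]; simp
  · rw [h]; exact memLp_comp_shift (memLp_cell_zero hp j) i

lemma integral_cell_zero (hp : p.WellDefined P₀) (j : Fin (p.KSb + 3)) :
    ∫ x, p.cell P₀ j 0 x ∂(iidLaw P₀) = 0 := by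
  unfold cell
  split_ifs with hj hi hj'
  · have hm : MeasurableSet {x : ℕ → 𝔛 | p.fSb (window p.LSb 0 x) ∈ p.α ⟨j, hj⟩} :=
      (measurable_window p.LSb 0) (p.measurableSet_preimage ⟨j, hj⟩)
    have e (x : ℕ → 𝔛) : (p.fSb ⁻¹' p.α ⟨j, hj⟩).indicator (fun _ => (1 : ℝ)) (window p.LSb 0 x) =
        {x : ℕ → 𝔛 | p.fSb (window p.LSb 0 x) ∈ p.α ⟨j, hj⟩}.indicator 1 x := rfl
    simp_rw [e]
    rw [integral_sub ((integrable_const _).indicator hm) (integrable_const _),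
      integral_indicator_one hm]
    simp [ESb]
  · simp
  · rw [integral_sub (hp.memLp_lb.integrable (by norm_num)) (integrable_const _)]
    simp [meanH0]
  · rw [integral_sub (hp.memLp_sum.integrable (by norm_num)) (integrable_const _)]
    simp [meanH0]

lemma integral_cell (hp : p.WellDefined P₀) (j : Fin (p.KSb + 3)) (i : ℕ) :
    ∫ x, p.cell P₀ j i x ∂(iidLaw P₀) = 0 := by
  rcases cell_eq_zero_or_shift (P₀ := P₀) j i with h | h
  · rw [h]; simp
  · rw [h]; exact (integral_comp_shift (measurable_cell j 0) i).trans (integral_cell_zero hp j)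

lemma eLpNorm_cell_le (j : Fin (p.KSb + 3)) (i : ℕ) :
    eLpNorm (p.cell P₀ j i) 1 (iidLaw P₀) ≤ eLpNorm (p.cell P₀ j 0) 1 (iidLaw P₀) := by
  rcases cell_eq_zero_or_shift (P₀ := P₀) j i with h | h
  · rw [h]; simp
  · rw [h]
    exact (eLpNorm_comp_measurePreserving (measurable_cell j 0).aestronglyMeasurable
      (measurePreserving_shift i)).le

/-- A centred coordinate of `f*` is a scaled sum of `h` consecutive centred summands. -/
lemma coord_sub_integral (hp : p.WellDefined P₀) {h : ℕ} (hL : p.LSb ∣ h) (j : Fin (p.KSb + 3))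
    (x : ℕ → 𝔛) :
    p.coord P₀ h j x - ∫ y, p.coord P₀ h j y ∂(iidLaw P₀) =
      p.scale P₀ j * ∑ u ∈ Finset.range h, p.cell P₀ j u x := by
  -- the two sides differ by a constant, which is the mean because the summands are centred
  obtain ⟨κ, hκ⟩ : ∃ κ, ∀ x, p.coord P₀ h j x =
      p.scale P₀ j * ∑ u ∈ Finset.range h, p.cell P₀ j u x + κ := by
    unfold coord scale cell
    split_ifs with hj hj'
    · obtain ⟨n, rfl⟩ := hL
      refine ⟨1 / √(p.ESb P₀ ⟨j, hj⟩) * (n * p.ESb P₀ ⟨j, hj⟩), fun x => ?_⟩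
      rw [Nat.mul_div_cancel_left _ p.LSb_pos, sum_range_mul_ite_dvd p.LSb_pos n
        (fun u => (p.fSb ⁻¹' p.α ⟨j, hj⟩).indicator (fun _ => (1 : ℝ)) (window p.LSb u x)
          - p.ESb P₀ ⟨j, hj⟩), Finset.sum_sub_distrib]
      simp
      ring
    · refine ⟨(p.σLb P₀)⁻¹ * (h * meanH0 P₀ p.fLb), fun x => ?_⟩
      simp [Finset.sum_sub_distrib]
      ring
    · refine ⟨(p.σSum P₀)⁻¹ * (h * meanH0 P₀ p.fSum), fun x => ?_⟩
      simp [Finset.sum_sub_distrib]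
      ring
  have hi (u : ℕ) : Integrable (p.cell P₀ j u) (iidLaw P₀) :=
    (memLp_cell hp j u).integrable (by norm_num)
  have h1 : ∫ y, p.coord P₀ h j y ∂(iidLaw P₀) = κ := by
    simp_rw [hκ]
    rw [integral_add ((integrable_finsetSum _ fun u _ => hi u).const_mul _) (integrable_const _),
      integral_const_mul, integral_finsetSum _ fun u _ => hi u]
    simp [integral_cell hp]
  rw [h1, hκ x]
  ring

end TripleParams

variable {Q : ℕ} {p : Fin Q → TripleParams 𝔛} {h s : ℕ}

/-- The centred coordinates `f* - E_{H₀} f*`. -/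
noncomputable def fStarCentred (p : Fin Q → TripleParams 𝔛) (P₀ : Measure 𝔛) (h : ℕ) (a : Idx p)
    (x : ℕ → 𝔛) : ℝ :=
  fStar p P₀ h a x - ∫ y, fStar p P₀ h a y ∂(iidLaw P₀)

lemma measurable_fStar (a : Idx p) : Measurable (fStar p P₀ h a) := by
  unfold fStar TripleParams.coord
  have h1 := (p a.1).measurable_fSum
  have h2 := (p a.1).measurable_fLb
  split_ifs with hj hj'
  · refine Measurable.const_mul (Finset.measurable_sum _ fun u _ => ?_) _
    exact (measurable_const.indicator ((p a.1).measurableSet_preimage _)).comp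
      (measurable_window _ _)
  · fun_prop
  · fun_prop

@[fun_prop]
lemma measurable_fStarCentred (a : Idx p) : Measurable (fStarCentred p P₀ h a) :=
  (measurable_fStar a).sub_const _

/-- The coordinates of `f*` depend only on the first `s` elements of the sequence. -/
lemma dependsOn_fStar (hs : sMin p h ≤ s) (hL : ∀ q, (p q).LSb ∣ h) (a : Idx p) :
    DependsOn (fStar p P₀ h a) (Set.Iio s) := by
  intro x y hxy
  have hsup := Finset.le_sup (f := fun q => max (p q).mSum (p q).mLb) (Finset.mem_univ a.1)
  have hm1 : (p a.1).mSum ≤ _ := (le_max_left _ _).trans hsup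
  have hm2 : (p a.1).mLb ≤ _ := (le_max_right _ _).trans hsup
  have hp1 := (p a.1).mSum_pos
  unfold sMin at hs
  unfold fStar TripleParams.coord
  split_ifs with hj hj'
  · congr 1
    refine Finset.sum_congr rfl fun u hu => ?_
    rw [window_congr _ hxy]
    have h1 : (p a.1).LSb * (u + 1) ≤ (p a.1).LSb * (h / (p a.1).LSb) :=
      Nat.mul_le_mul_left _ (Finset.mem_range.1 hu)
    rw [Nat.mul_div_cancel' (hL a.1), mul_add_one] at h1
    omega
  · congr 1
    refine Finset.sum_congr rfl fun u hu => ?_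
    rw [window_congr _ hxy]
    have := Finset.mem_range.1 hu
    omega
  · congr 1
    refine Finset.sum_congr rfl fun u hu => ?_
    rw [window_congr _ hxy]
    have := Finset.mem_range.1 hu
    omega

lemma dependsOn_fStarCentred (hs : sMin p h ≤ s) (hL : ∀ q, (p q).LSb ∣ h) (a : Idx p) :
    DependsOn (fStarCentred p P₀ h a) (Set.Iio s) := fun _ _ hxy => by
  rw [fStarCentred, fStarCentred, dependsOn_fStar hs hL a hxy]

variable [IsProbabilityMeasure P₀]

lemma fStarCentred_eq (hp : ∀ q, (p q).WellDefined P₀) (hL : ∀ q, (p q).LSb ∣ h) (a : Idx p)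
    (x : ℕ → 𝔛) :
    fStarCentred p P₀ h a x =
      (p a.1).scale P₀ a.2 * ∑ u ∈ Finset.range h, (p a.1).cell P₀ a.2 u x :=
  TripleParams.coord_sub_integral (hp a.1) (hL a.1) a.2 x

lemma memLp_fStarCentred (hp : ∀ q, (p q).WellDefined P₀) (hL : ∀ q, (p q).LSb ∣ h) (a : Idx p) :
    MemLp (fStarCentred p P₀ h a) 2 (iidLaw P₀) := by
  rw [funext (fStarCentred_eq hp hL a)]
  exact (memLp_finsetSum _ fun u _ => TripleParams.memLp_cell (hp a.1) a.2 u).const_mul _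

lemma integral_fStarCentred (hp : ∀ q, (p q).WellDefined P₀) (hL : ∀ q, (p q).LSb ∣ h)
    (a : Idx p) : ∫ x, fStarCentred p P₀ h a x ∂(iidLaw P₀) = 0 := by
  rw [funext (fStarCentred_eq hp hL a), integral_const_mul, integral_finsetSum _ fun u _ =>
    (TripleParams.memLp_cell (hp a.1) a.2 u).integrable (by norm_num)]
  simp [TripleParams.integral_cell (hp a.1)]

end Coordinates

/-! ### The covariance matrix `Φ*` -/

section CovarianceMatrix

variable {𝔛 : Type*} [MeasurableSpace 𝔛] {P₀ : Measure 𝔛} [IsProbabilityMeasure P₀]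
  {Q : ℕ} {p : Fin Q → TripleParams 𝔛} {h s : ℕ}

/-- The linear combination of the centred coordinates of `f*` with coefficients `t`. -/
noncomputable def linComb (p : Fin Q → TripleParams 𝔛) (P₀ : Measure 𝔛) (h : ℕ) (t : Idx p → ℝ)
    (x : ℕ → 𝔛) : ℝ :=
  ∑ a, t a * fStarCentred p P₀ h a x

omit [IsProbabilityMeasure P₀] in
lemma measurable_linComb (t : Idx p → ℝ) : Measurable (linComb p P₀ h t) := by
  unfold linComb; fun_prop

lemma memLp_linComb (hp : ∀ q, (p q).WellDefined P₀) (hL : ∀ q, (p q).LSb ∣ h) (t : Idx p → ℝ) :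
    MemLp (linComb p P₀ h t) 2 (iidLaw P₀) :=
  memLp_finsetSum _ fun a _ => (memLp_fStarCentred hp hL a).const_mul _

lemma integral_linComb (hp : ∀ q, (p q).WellDefined P₀) (hL : ∀ q, (p q).LSb ∣ h)
    (t : Idx p → ℝ) : ∫ x, linComb p P₀ h t x ∂(iidLaw P₀) = 0 := by
  unfold linComb
  rw [integral_finsetSum _ fun a _ =>
    ((memLp_fStarCentred hp hL a).integrable (by norm_num)).const_mul _]
  simp [integral_const_mul, integral_fStarCentred hp hL]

omit [IsProbabilityMeasure P₀] in
lemma dependsOn_linComb (hs : sMin p h ≤ s) (hL : ∀ q, (p q).LSb ∣ h) (t : Idx p → ℝ) :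
    DependsOn (linComb p P₀ h t) (Set.Iio s) := fun _ _ hxy =>
  Finset.sum_congr rfl fun a _ => by rw [dependsOn_fStarCentred hs hL a hxy]

lemma memLp_fStar (hp : ∀ q, (p q).WellDefined P₀) (hL : ∀ q, (p q).LSb ∣ h) (a : Idx p) :
    MemLp (fStar p P₀ h a) 2 (iidLaw P₀) := by
  have := (memLp_fStarCentred hp hL a).add (memLp_const (∫ y, fStar p P₀ h a y ∂(iidLaw P₀)))
  refine this.ae_eq (ae_of_all _ fun x => ?_)
  simp [fStarCentred]

lemma covariance_ZStar (hp : ∀ q, (p q).WellDefined P₀) (hL : ∀ q, (p q).LSb ∣ h) (i : ℕ)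
    (a b : Idx p) :
    cov[ZStar p P₀ h 1 a, ZStar p P₀ h (i + 1) b; iidLaw P₀] =
      cov[fStarCentred p P₀ h a, fun x => fStarCentred p P₀ h b (shift (h * i) x);
        iidLaw P₀] := by
  have e1 : ZStar p P₀ h 1 a = fStar p P₀ h a := by funext x; simp [ZStar]
  have e2 : ZStar p P₀ h (i + 1) b = fun x => fStar p P₀ h b (shift (h * i) x) := by
    funext x; simp only [ZStar, Nat.add_sub_cancel]; rfl
  have h1 := (memLp_fStar hp hL a).integrable (μ := iidLaw P₀) (by norm_num)
  have h2 := (memLp_comp_shift (memLp_fStar hp hL b) (h * i)).integrable (by norm_num)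
  unfold fStarCentred
  rw [e1, e2]
  rw [covariance_sub_const_left h1, covariance_sub_const_right h2]

lemma covariance_linComb (hp : ∀ q, (p q).WellDefined P₀) (hL : ∀ q, (p q).LSb ∣ h) (i : ℕ)
    (t : Idx p → ℝ) :
    cov[linComb p P₀ h t, fun x => linComb p P₀ h t (shift (h * i) x); iidLaw P₀] =
      ∑ a, ∑ b, t a * t b *
        cov[ZStar p P₀ h 1 a, ZStar p P₀ h (i + 1) b; iidLaw P₀] := by
  unfold linComb
  rw [covariance_fun_sum_fun_sum (fun a => (memLp_fStarCentred hp hL a).const_mul _)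
    (fun a => (memLp_comp_shift (memLp_fStarCentred hp hL a) (h * i)).const_mul _)]
  refine Finset.sum_congr rfl fun a _ => Finset.sum_congr rfl fun b _ => ?_
  rw [covariance_const_mul_left, covariance_const_mul_right, covariance_ZStar hp hL]
  ring

/-- The quadratic form of `Φ*` gives the asymptotic variances of the linear combinations. -/
lemma limVar_linComb (hp : ∀ q, (p q).WellDefined P₀) (hL : ∀ q, (p q).LSb ∣ h)
    (t : Idx p → ℝ) :
    limVar P₀ (linComb p P₀ h t) h ((s - 1) / h + 1) =
      ∑ a, ∑ b, t a * t b * PhiStar p P₀ s h a b := by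
  have h0 : Var[linComb p P₀ h t; iidLaw P₀] =
      ∑ a, ∑ b, t a * t b * cov[ZStar p P₀ h 1 a, ZStar p P₀ h 1 b; iidLaw P₀] := by
    have := covariance_linComb hp hL 0 t
    simp only [mul_zero, shift_zero, zero_add] at this
    rw [← this, covariance_self (measurable_linComb t).aemeasurable]
  have hswap (i : ℕ) : 2 * ∑ a, ∑ b, t a * t b *
        cov[ZStar p P₀ h 1 a, ZStar p P₀ h (i + 1) b; iidLaw P₀] =
      ∑ a, ∑ b, t a * t b * (cov[ZStar p P₀ h 1 a, ZStar p P₀ h (i + 1) b; iidLaw P₀] +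
        cov[ZStar p P₀ h 1 b, ZStar p P₀ h (i + 1) a; iidLaw P₀]) := by
    simp only [mul_add, Finset.sum_add_distrib]
    rw [two_mul]
    congr 1
    rw [Finset.sum_comm]
    exact Finset.sum_congr rfl fun a _ => Finset.sum_congr rfl fun b _ => by ring
  rw [limVar, h0, Finset.mul_sum]
  simp only [covariance_linComb hp hL, hswap]
  have hcomm (F : ℕ → Idx p → Idx p → ℝ) : ∑ i ∈ Finset.Ico 1 ((s - 1) / h + 1), ∑ a, ∑ b, F i a b =
      ∑ a, ∑ b, ∑ i ∈ Finset.Ico 1 ((s - 1) / h + 1), F i a b := by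
    rw [Finset.sum_comm]
    exact Finset.sum_congr rfl fun a _ => Finset.sum_comm
  have hPhi (a b : Idx p) : PhiStar p P₀ s h a b =
      cov[ZStar p P₀ h 1 a, ZStar p P₀ h 1 b; iidLaw P₀] +
      ∑ i ∈ Finset.Ico 1 ((s - 1) / h + 1),
        (cov[ZStar p P₀ h 1 a, ZStar p P₀ h (i + 1) b; iidLaw P₀] +
          cov[ZStar p P₀ h 1 b, ZStar p P₀ h (i + 1) a; iidLaw P₀]) := by
    have := Finset.sum_Ico_add' (fun i => cov[ZStar p P₀ h 1 a, ZStar p P₀ h i b; iidLaw P₀] +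
      cov[ZStar p P₀ h 1 b, ZStar p P₀ h i a; iidLaw P₀]) 1 ((s - 1) / h + 1) 1
    rw [this]
    rfl
  rw [hcomm]
  simp only [hPhi, mul_add, Finset.mul_sum, Finset.sum_add_distrib]

lemma le_mul_div_add_one (hh : 0 < h) (s : ℕ) : s ≤ h * ((s - 1) / h + 1) := by
  have := Nat.lt_mul_div_succ (s - 1) hh
  omega

lemma sum_mul_PhiStar_nonneg (hp : ∀ q, (p q).WellDefined P₀) (hL : ∀ q, (p q).LSb ∣ h)
    (hs : sMin p h ≤ s) (hh : 0 < h) (t : Idx p → ℝ) :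
    0 ≤ ∑ a, ∑ b, t a * t b * PhiStar p P₀ s h a b := by
  rw [← limVar_linComb hp hL]
  exact limVar_nonneg (measurable_linComb t) (memLp_linComb hp hL t) (dependsOn_linComb hs hL t)
    (le_mul_div_add_one hh s)

lemma posSemidef_PhiStar (hp : ∀ q, (p q).WellDefined P₀) (hL : ∀ q, (p q).LSb ∣ h)
    (hs : sMin p h ≤ s) (hh : 0 < h) : (PhiStar p P₀ s h).PosSemidef := by
  refine .of_dotProduct_mulVec_nonneg ?_ fun t => ?_
  · ext a b
    simp only [Matrix.conjTranspose_apply, star_trivial, PhiStar, Matrix.of_apply]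
    rw [covariance_comm]
    congr 1
    exact Finset.sum_congr rfl fun i _ => add_comm _ _
  · refine (sum_mul_PhiStar_nonneg hp hL hs hh t).trans_eq ?_
    simp only [dotProduct, Matrix.mulVec, star_trivial, Finset.mul_sum, Pi.star_apply]
    exact Finset.sum_congr rfl fun a _ => Finset.sum_congr rfl fun b _ => by ring

end CovarianceMatrix

/-! ### Joint convergence of the vectors `𝒳*` and `𝒴` -/

section JointCLT

variable {𝔛 : Type*} [MeasurableSpace 𝔛] {P₀ : Measure 𝔛}
  {Q : ℕ} {p : Fin Q → TripleParams 𝔛} {N h s : ℕ}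

/-- The index of the first summand of `𝒳*_{k+1}`. -/
def blockStart (N h n k : ℕ) : ℕ := (n / N * k + h - 1) / h

/-- The index following that of the last summand of `𝒳*_{k+1}`. -/
def blockEnd (N s h n k : ℕ) : ℕ := (n / N * (k + 1) - s) / h + 1

/-- The summands of `𝒳*_{k+1}` have consecutive indices, as soon as the blocks have at least `s`
elements. -/
lemma filter_range_eq_Ico (hh : 0 < h) {n k : ℕ} (hn : s ≤ n / N) (hk : k < N) :
    (Finset.range (n + 1)).filter (fun i => n / N * k ≤ h * i ∧ h * i + s ≤ n / N * (k + 1)) =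
      Finset.Ico (blockStart N h n k) (blockEnd N s h n k) := by
  have h1 : n / N * (k + 1) ≤ n :=
    (Nat.mul_le_mul_left _ hk).trans (Nat.div_mul_le_self n N)
  have h2 : s ≤ n / N * (k + 1) := hn.trans (Nat.le_mul_of_pos_right _ (Nat.succ_pos k))
  ext i
  simp only [Finset.mem_filter, Finset.mem_range, Finset.mem_Ico, blockStart, blockEnd]
  rw [Nat.lt_succ_iff, Nat.lt_succ_iff, Nat.le_div_iff_mul_le hh,
    ← Nat.lt_succ_iff (m := (n / N * k + h - 1) / h), Nat.div_lt_iff_lt_mul hh, mul_comm i h,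
    Nat.succ_mul, mul_comm i h]
  have h3 : i ≤ h * i := Nat.le_mul_of_pos_left _ hh
  omega

lemma le_mul_blockStart (hh : 0 < h) (n k : ℕ) : n / N * k ≤ h * blockStart N h n k := by
  have := Nat.lt_mul_div_succ (n / N * k + h - 1) hh
  unfold blockStart
  rw [mul_add_one] at this
  omega

lemma mul_blockStart_le (n k : ℕ) : h * blockStart N h n k ≤ n / N * k + h := by
  have := Nat.mul_div_le (n / N * k + h - 1) h
  unfold blockStart
  omega

lemma le_mul_blockEnd (hh : 0 < h) (n k : ℕ) :
    n / N * (k + 1) ≤ h * blockEnd N s h n k + s := by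
  have := Nat.lt_mul_div_succ (n / N * (k + 1) - s) hh
  unfold blockEnd
  omega

lemma mul_blockEnd_le (n k : ℕ) :
    h * blockEnd N s h n k ≤ n / N * (k + 1) + h := by
  have := Nat.mul_div_le (n / N * (k + 1) - s) h
  unfold blockEnd
  rw [mul_add_one]
  omega

lemma tendsto_natDiv_atTop (hN : 0 < N) : Tendsto (fun n : ℕ => n / N) atTop atTop :=
  Nat.tendsto_div_const_atTop hN.ne'

lemma tendsto_blockEnd_sub_blockStart_div (hN : 0 < N) (hh : 0 < h) (k : ℕ) :
    Tendsto (fun n : ℕ => ((blockEnd N s h n k - blockStart N h n k : ℕ) : ℝ) / n) atTop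
      (𝓝 (1 / (N * h))) := by
  refine tendsto_div_of_abs_sub_le (D := s + h + 1) ?_
  filter_upwards [(tendsto_natDiv_atTop hN).eventually_ge_atTop (s + h)] with n hn
  have h1 := le_mul_blockStart (N := N) hh n k
  have h2 := mul_blockStart_le (N := N) (h := h) n k
  have h3 := le_mul_blockEnd (N := N) (s := s) hh n k
  have h4 := mul_blockEnd_le (N := N) (s := s) (h := h) n k
  set L := n / N with hL
  have hle : blockStart N h n k ≤ blockEnd N s h n k := by
    refine Nat.le_of_mul_le_mul_left (c := h) ?_ hh
    rw [mul_add_one] at h3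
    omega
  obtain ⟨m, hm⟩ := Nat.exists_eq_add_of_le hle
  rw [hm, Nat.add_sub_cancel_left]
  rw [hm, mul_add h, mul_add_one L] at h3 h4
  have h5 : L ≤ h * m + s + h := by omega
  have h6 : h * m ≤ L + h := by omega
  have h7 := abs_le.1 (abs_natCast_div_sub_le hN n)
  rw [← hL] at h7
  have h5' : (L : ℝ) ≤ h * m + s + h := by exact_mod_cast h5
  have h6' : (h : ℝ) * m ≤ L + h := by exact_mod_cast h6
  have hh1 : (1 : ℝ) ≤ h := by exact_mod_cast hh
  have hs0 : (0 : ℝ) ≤ s := by positivity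
  have e : (m : ℝ) - 1 / (N * h) * n = (h * m - 1 / N * n) / h := by field_simp
  rw [e, abs_div, abs_of_pos (show (0 : ℝ) < h by linarith), div_le_iff₀ (by linarith)]
  have h8 : |(h : ℝ) * m - 1 / N * n| ≤ s + h + 1 := by
    rw [abs_le]; constructor <;> linarith [h7.1, h7.2]
  exact h8.trans (le_mul_of_one_le_right (by positivity) hh1)

lemma XStar_eq (N s h n k : ℕ) (a : Idx p) (x : ℕ → 𝔛) :
    XStar p P₀ N s h n k a x = 1 / √(n : ℝ) * ∑ i ∈ (Finset.range (n + 1)).filter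
      (fun i => n / N * k ≤ h * i ∧ h * i + s ≤ n / N * (k + 1)),
        fStarCentred p P₀ h a (shift (h * i) x) := rfl

lemma measurable_XStar (N s h n k : ℕ) (a : Idx p) : Measurable (XStar p P₀ N s h n k a) := by
  rw [funext (XStar_eq N s h n k a)]
  fun_prop

/-- `𝒳*_{k+1}` depends only on the elements of the block number `k` of length `⌊n / N⌋`. -/
lemma dependsOn_XStar (hs : sMin p h ≤ s) (hL : ∀ q, (p q).LSb ∣ h) (n k : ℕ) (a : Idx p) :
    DependsOn (XStar p P₀ N s h n k a) (Set.Ico (n / N * k) (n / N * k + n / N)) := by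
  intro x y hxy
  rw [XStar_eq, XStar_eq]
  congr 1
  refine Finset.sum_congr rfl fun i hi => ?_
  simp only [Finset.mem_filter, mul_add_one] at hi
  refine ((dependsOn_fStarCentred hs hL a).shift (h * i)) fun t ht => hxy t ?_
  have h1 := ht.1
  have h2 := ht.2
  simp only [Set.mem_Ico]
  omega

variable [IsProbabilityMeasure P₀]

/-- Asymptotic normality of the linear combinations of the coordinates of one vector `𝒳*_{k+1}`,
which is a sum over about `n / (N h)` shifts. -/
lemma tendsto_charFun_sum_XStar (hp : ∀ q, (p q).WellDefined P₀) (hL : ∀ q, (p q).LSb ∣ h)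
    (hs : sMin p h ≤ s) (hN : 0 < N) (hh : 0 < h) {k : ℕ} (hk : k < N) (t : Idx p → ℝ) :
    Tendsto (fun n => charFun ((iidLaw P₀).map fun x => ∑ a, t a * XStar p P₀ N s h n k a x) 1)
      atTop (𝓝 (Complex.exp
        (-((∑ a, ∑ b, t a * t b * PhiStar p P₀ s h a b) * (1 / (N * h)) / 2 : ℝ)))) := by
  have hGm := measurable_linComb (P₀ := P₀) (h := h) t
  have hsr := le_mul_div_add_one hh s
  have hGd := dependsOn_linComb (P₀ := P₀) hs hL t
  have hG2 := memLp_linComb hp hL t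
  have hclt := tendstoInDistribution_shiftSum hGm hG2 (integral_linComb hp hL t) hGd hsr
    (Nat.succ_pos _)
  have hℓc := tendsto_blockEnd_sub_blockStart_div (s := s) hN hh k
  have hℓ : Tendsto (fun n => blockEnd N s h n k - blockStart N h n k) atTop atTop := by
    have h1 : Tendsto (fun n : ℕ => ((blockEnd N s h n k - blockStart N h n k : ℕ) : ℝ) / n * n)
        atTop atTop :=
      hℓc.pos_mul_atTop (by positivity) tendsto_natCast_atTop_atTop
    rw [← tendsto_natCast_atTop_iff (R := ℝ)]
    refine h1.congr' ?_
    filter_upwards [eventually_gt_atTop 0] with n hn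
    have : (n : ℝ) ≠ 0 := by exact_mod_cast hn.ne'
    field_simp
  have h1 := tendsto_charFun_inv_sqrt_mul_comp
    (fun m => (measurable_shiftSum hGm h m).aemeasurable) (limVar_nonneg hGm hG2 hGd hsr)
    (by positivity) hclt hℓ hℓc 1
  rw [limVar_linComb hp hL, one_pow, mul_one] at h1
  refine h1.congr' ?_
  filter_upwards [(tendsto_natDiv_atTop hN).eventually_ge_atTop s] with n hn
  have e (x : ℕ → 𝔛) : ∑ a, t a * XStar p P₀ N s h n k a x =
      (√(n : ℝ))⁻¹ * shiftSum (linComb p P₀ h t) h (blockEnd N s h n k - blockStart N h n k)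
        (shift (h * blockStart N h n k) x) := by
    simp only [XStar_eq, filter_range_eq_Ico hh hn hk, shiftSum, linComb]
    rw [Finset.sum_comm, Finset.mul_sum]
    refine Finset.sum_congr rfl fun a _ => ?_
    rw [Finset.sum_Ico_eq_sum_range, ← Finset.mul_sum]
    simp only [shift_shift, mul_add, one_div]
    ring
  simp_rw [e]
  rw [map_comp_shift (G := fun x => (√(n : ℝ))⁻¹ * shiftSum (linComb p P₀ h t) h
    (blockEnd N s h n k - blockStart N h n k) x) ((measurable_shiftSum hGm h _).const_mul _)]

/-- The characteristic function of a family of vectors, if the linear combinations of their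
coordinates are independent. -/
lemma charFun_map_toLp_eq {Ω K A : Type*} [MeasurableSpace Ω] {P : Measure Ω}
    [IsProbabilityMeasure P] [Fintype K] [Fintype A] {U : K → A → Ω → ℝ}
    (hU : ∀ k a, AEMeasurable (U k a) P) (t : EuclideanSpace ℝ (K × A))
    (hind : iIndepFun (fun k ω => ∑ a, t (k, a) * U k a ω) P) :
    charFun (P.map fun ω => (WithLp.toLp 2 fun b : K × A => U b.1 b.2 ω :
        EuclideanSpace ℝ (K × A))) t =
      ∏ k, charFun (P.map fun ω => ∑ a, t (k, a) * U k a ω) 1 := by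
  have hm (k : K) : AEMeasurable (fun ω => ∑ a, t (k, a) * U k a ω) P :=
    Finset.aemeasurable_fun_sum _ fun a _ => (hU k a).const_mul _
  have h1 := congrFun (hind.charFun_map_fun_sum_eq_prod hm) 1
  rw [Finset.prod_apply] at h1
  rw [← h1, charFun_apply, charFun_apply_real, integral_map _ (by fun_prop),
    integral_map (Finset.aemeasurable_fun_sum _ fun k _ => hm k) (by fun_prop)]
  · refine integral_congr_ae (ae_of_all _ fun ω => ?_)
    simp [PiLp.inner_apply, Fintype.sum_prod_type]
  · exact (WithLp.measurable_toLp 2 _).comp_aemeasurable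
      (aemeasurable_pi_lambda _ fun b => hU b.1 b.2)

/-- The vectors `𝒳*₁, …, 𝒳*_N` converge jointly in distribution to `η*₁, …, η*_N`. -/
lemma tendstoInDistribution_XStar (hp : ∀ q, (p q).WellDefined P₀) (hL : ∀ q, (p q).LSb ∣ h)
    (hs : sMin p h ≤ s) (hN : 0 < N) (hh : 0 < h)
    {Ω' : Type*} [MeasurableSpace Ω'] {μ' : Measure Ω'} [IsProbabilityMeasure μ']
    {η : ℕ → Ω' → EuclideanSpace ℝ (Idx p)} (hη_indep : iIndepFun (fun k : Fin N => η k) μ')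
    (hη_law : ∀ k : Fin N, HasLaw (η k)
      (multivariateGaussian 0 ((1 / ((N : ℝ) * h)) • PhiStar p P₀ s h)) μ') :
    TendstoInDistribution
      (fun n x => (WithLp.toLp 2 fun b : Fin N × Idx p => XStar p P₀ N s h n b.1 b.2 x :
        EuclideanSpace ℝ (Fin N × Idx p))) atTop
      (fun ω => WithLp.toLp 2 fun b : Fin N × Idx p => η b.1 ω b.2) (fun _ => iidLaw P₀) μ' := by
  have hXm (n : ℕ) (k : Fin N) (a : Idx p) := measurable_XStar (P₀ := P₀) N s h n k a
  have hηm (k : Fin N) (a : Idx p) : AEMeasurable (fun ω => η k ω a) μ' :=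
    (by fun_prop : Measurable fun v : EuclideanSpace ℝ (Idx p) => v a).comp_aemeasurable
      (hη_law k).aemeasurable
  refine ⟨fun n => (WithLp.measurable_toLp 2 _).comp_aemeasurable
      (aemeasurable_pi_lambda _ fun b => (hXm n b.1 b.2).aemeasurable),
    (WithLp.measurable_toLp 2 _).comp_aemeasurable
      (aemeasurable_pi_lambda _ fun b => hηm b.1 b.2), ?_⟩
  refine ProbabilityMeasure.tendsto_iff_tendsto_charFun.2 fun t => ?_
  simp only [ProbabilityMeasure.coe_mk]
  rw [charFun_map_toLp_eq hηm t (hη_indep.comp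
    (fun k v => ∑ a, t (k, a) * v a) fun k => by fun_prop)]
  have hX (n : ℕ) := charFun_map_toLp_eq (P := iidLaw P₀)
    (U := fun (k : Fin N) a x => XStar p P₀ N s h n k a x)
    (fun k a => (hXm n k a).aemeasurable) t (by
      -- the blocks are numbered by `ℕ`, so the coefficients are extended by zero
      have h1 : iIndepFun (fun (k : ℕ) (x : ℕ → 𝔛) => ∑ a, (if hk : k < N then t (⟨k, hk⟩, a)
          else 0) * XStar p P₀ N s h n k a x) (iidLaw P₀) := by
        refine iIndepFun_of_dependsOn_blocks (fun k => ?_) 0 (n / N) fun k => ?_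
        · exact Finset.measurable_sum _ fun a _ => (measurable_XStar N s h n k a).const_mul _
        · simp only [zero_add]
          intro x y hxy
          exact Finset.sum_congr rfl fun a _ => by rw [dependsOn_XStar hs hL n k a hxy]
      have h2 := h1.precomp (g := fun k : Fin N => (k : ℕ)) Fin.val_injective
      simpa using h2)
  simp_rw [hX]
  refine tendsto_finsetProd _ fun k _ => ?_
  have hlim := tendsto_charFun_sum_XStar hp hL hs hN hh k.2 fun a => t (k, a)
  convert hlim using 2
  have hΦ : ((1 / ((N : ℝ) * h)) • PhiStar p P₀ s h).PosSemidef :=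
    (posSemidef_PhiStar hp hL hs hh).smul (by positivity)
  have h1 := charFun_multivariateGaussian (μ := 0) hΦ (WithLp.toLp 2 fun a => t (k, a))
  rw [← (hη_law k).map_eq, charFun_apply, integral_map (hη_law k).aemeasurable
    (by fun_prop)] at h1
  rw [charFun_apply_real, integral_map (Finset.aemeasurable_fun_sum _ fun a _ =>
    (hηm k a).const_mul _) (by fun_prop)]
  convert h1 using 1
  · refine integral_congr_ae (ae_of_all _ fun ω => ?_)
    simp [PiLp.inner_apply]
  · congr 1
    simp only [inner_zero_right, dotProduct, Matrix.mulVec, Matrix.smul_apply, smul_eq_mul,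
      Finset.mul_sum, Finset.sum_mul]
    push_cast
    simp only [Finset.sum_div, ← Finset.sum_neg_distrib, zero_mul,
      zero_sub]
    refine Finset.sum_congr rfl fun a _ => Finset.sum_congr rfl fun b _ => by ring

lemma mul_natDiv_add_lt {m : ℕ} (hm : m ∣ N) {k i : ℕ} (hk : k < m) (hi : i < N / m) :
    N / m * k + i < N := by
  have h1 : N / m * (k + 1) ≤ N / m * m := Nat.mul_le_mul_left _ hk
  rw [Nat.div_mul_cancel hm, mul_add_one] at h1
  omega

/-- The vector of all `𝒴_k^{[q]}` converges in distribution to the vector of all `ζ_k^{[q]}`. -/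
lemma tendstoInDistribution_YVec (hp : ∀ q, (p q).WellDefined P₀) (hL : ∀ q, (p q).LSb ∣ h)
    (hs : sMin p h ≤ s) (hN : 0 < N) (hh : 0 < h) (hNlb : ∀ q, (p q).NLb ∣ N)
    {Ω' : Type*} [MeasurableSpace Ω'] {μ' : Measure Ω'} [IsProbabilityMeasure μ']
    {η : ℕ → Ω' → EuclideanSpace ℝ (Idx p)} (hη_indep : iIndepFun (fun k : Fin N => η k) μ')
    (hη_law : ∀ k : Fin N, HasLaw (η k)
      (multivariateGaussian 0 ((1 / ((N : ℝ) * h)) • PhiStar p P₀ s h)) μ') :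
    TendstoInDistribution (fun n x => YVec p P₀ N s h n x) atTop
      (fun ω => blockVec p N fun k a => η k ω a) (fun _ => iidLaw P₀) μ' := by
  have hidx (b : BlockIdx p) {i : ℕ} (hi : i ∈ Finset.range (N / (p b.1).NLb)) :
      N / (p b.1).NLb * (b.2.1 : ℕ) + i < N :=
    mul_natDiv_add_lt (hNlb b.1) b.2.1.2 (Finset.mem_range.1 hi)
  -- `blockVec p N` reads only the vectors with numbers `< N`, so it factors through this map
  let g : EuclideanSpace ℝ (Fin N × Idx p) → BlockIdx p → ℝ := fun v =>
    blockVec p N fun k a => if hk : k < N then v (⟨k, hk⟩, a) else 0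
  have hg : Continuous g := by
    refine continuous_pi fun b => continuous_finsetSum _ fun i hi => ?_
    simp only [hidx b hi, dif_pos]
    fun_prop
  have key (w : ℕ → Idx p → ℝ) :
      blockVec p N w = g (WithLp.toLp 2 fun b : Fin N × Idx p => w b.1 b.2) := by
    funext b
    refine Finset.sum_congr rfl fun i hi => ?_
    simp [hidx b hi]
  have h1 := (tendstoInDistribution_XStar hp hL hs hN hh hη_indep hη_law).continuous_comp hg
  simp only [YVec, key]
  exact h1

end JointCLT

/-! ### Approximation of normalized sums by sums of the vectors `𝒳*` -/

section Approximation

variable {𝔛 : Type*} [MeasurableSpace 𝔛] {P₀ : Measure 𝔛} {Q : ℕ} {p : Fin Q → TripleParams 𝔛}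
  {N h s : ℕ}

/-- The sum of the centred summands of a coordinate over the first `m` positions. -/
noncomputable def cellSum (p : Fin Q → TripleParams 𝔛) (P₀ : Measure 𝔛) (a : Idx p) (m : ℕ)
    (x : ℕ → 𝔛) : ℝ :=
  ∑ i ∈ Finset.range m, (p a.1).cell P₀ a.2 i x

@[fun_prop]
lemma measurable_cellSum (a : Idx p) (m : ℕ) : Measurable (cellSum p P₀ a m) :=
  Finset.measurable_sum _ fun _ _ => TripleParams.measurable_cell _ _

lemma sum_range_cell_block (a : Idx p) (m : ℕ) (x : ℕ → 𝔛) :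
    ∑ i ∈ Finset.range m, ∑ u ∈ Finset.range h, (p a.1).cell P₀ a.2 (h * i + u) x =
      cellSum p P₀ a (h * m) x := by
  induction m with
  | zero => simp [cellSum]
  | succ m ih => rw [Finset.sum_range_succ, ih, cellSum, cellSum, mul_add_one,
      Finset.sum_range_add]

lemma eLpNorm_cellSum_sub_le [IsProbabilityMeasure P₀] (a : Idx p) {m m' D : ℕ} (h1 : m ≤ m' + D)
    (h2 : m' ≤ m + D) :
    eLpNorm (fun x => cellSum p P₀ a m x - cellSum p P₀ a m' x) 1 (iidLaw P₀) ≤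
      D * eLpNorm ((p a.1).cell P₀ a.2 0) 1 (iidLaw P₀) := by
  wlog hle : m' ≤ m generalizing m m'
  · have h3 := this h2 h1 (le_of_not_ge hle)
    rw [← eLpNorm_neg] at h3
    refine le_of_eq_of_le ?_ h3
    congr 1
    funext x
    simp
  have e : (fun x => cellSum p P₀ a m x - cellSum p P₀ a m' x) =
      ∑ i ∈ Finset.Ico m' m, (p a.1).cell P₀ a.2 i := by
    funext x
    rw [Finset.sum_apply, cellSum, cellSum, Finset.sum_Ico_eq_sub _ hle]
  rw [e]
  refine (eLpNorm_sum_le (fun i _ => (TripleParams.measurable_cell _ _).aestronglyMeasurable)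
    le_rfl).trans ?_
  refine (Finset.sum_le_card_nsmul _ _ _ fun i _ => TripleParams.eLpNorm_cell_le _ _).trans ?_
  rw [nsmul_eq_mul, Nat.card_Ico]
  gcongr
  omega

lemma TripleParams.eLpNorm_cell_zero_ne_top [IsProbabilityMeasure P₀] {p : TripleParams 𝔛}
    (hp : p.WellDefined P₀) (j : Fin (p.KSb + 3)) :
    eLpNorm (p.cell P₀ j 0) 1 (iidLaw P₀) ≠ ∞ :=
  ((TripleParams.memLp_cell_zero hp j).mono_exponent (by norm_num)).eLpNorm_ne_top

variable [IsProbabilityMeasure P₀]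

lemma XStar_eq_cellSum (hp : ∀ q, (p q).WellDefined P₀) (hL : ∀ q, (p q).LSb ∣ h) (hh : 0 < h)
    {n k : ℕ} (hn : s + h ≤ n / N) (hk : k < N) (a : Idx p) (x : ℕ → 𝔛) :
    XStar p P₀ N s h n k a x = 1 / √(n : ℝ) * ((p a.1).scale P₀ a.2 *
      (cellSum p P₀ a (h * blockEnd N s h n k) x -
        cellSum p P₀ a (h * blockStart N h n k) x)) := by
  have h2 := mul_blockStart_le (N := N) (h := h) n k
  have h3 := le_mul_blockEnd (N := N) (s := s) hh n k
  have hle : blockStart N h n k ≤ blockEnd N s h n k := by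
    refine Nat.le_of_mul_le_mul_left (c := h) ?_ hh
    rw [mul_add_one] at h3
    omega
  rw [XStar_eq, filter_range_eq_Ico hh (by omega) hk, ← sum_range_cell_block a,
    ← sum_range_cell_block a, ← Finset.sum_Ico_eq_sub _ hle]
  congr 1
  rw [Finset.mul_sum]
  refine Finset.sum_congr rfl fun i _ => ?_
  rw [fStarCentred_eq hp hL]
  simp only [TripleParams.cell_shift ((hL a.1).mul_right i)]

/-- If the ends of an interval of positions differ by bounded amounts from the ends of the union
of `M` consecutive blocks of length `⌊n / N⌋`, the normalized sum of the summands of a coordinate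
over the interval is approximated in probability by the sum of the vectors `𝒳*` of these blocks:
only boundedly many summands are counted in one of them and not in the other. -/
lemma tendstoInMeasure_cellSum_sub (hp : ∀ q, (p q).WellDefined P₀) (hL : ∀ q, (p q).LSb ∣ h)
    (hN : 0 < N) (hh : 0 < h) (a : Idx p) {κ M D : ℕ} (hκ : κ + M ≤ N) {α β : ℕ → ℕ}
    (hα1 : ∀ n, α n ≤ n / N * κ + D) (hα2 : ∀ n, n / N * κ ≤ α n + D)
    (hβ1 : ∀ n, β n ≤ n / N * (κ + M) + D) (hβ2 : ∀ n, n / N * (κ + M) ≤ β n + D) :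
    TendstoInMeasure (iidLaw P₀)
      (fun (n : ℕ) x => 1 / √(n : ℝ) * ((p a.1).scale P₀ a.2 *
          (cellSum p P₀ a (β n) x - cellSum p P₀ a (α n) x)) -
        ∑ i ∈ Finset.range M, XStar p P₀ N s h n (κ + i) a x) atTop (fun _ => 0) := by
  set C := eLpNorm ((p a.1).cell P₀ a.2 0) 1 (iidLaw P₀) with hC
  have hCtop : C ≠ ∞ := TripleParams.eLpNorm_cell_zero_ne_top (hp a.1) a.2
  have hXm (n k : ℕ) := measurable_XStar (P₀ := P₀) N s h n k a
  refine tendstoInMeasure_of_tendsto_eLpNorm (p := 1) one_ne_zero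
    (fun n => (by fun_prop : Measurable _).aestronglyMeasurable) aestronglyMeasurable_const ?_
  let B : ℝ≥0∞ := D * C + D * C + M * (((s + h : ℕ) : ℝ≥0∞) * C + ((s + h : ℕ) : ℝ≥0∞) * C)
  have hB : B ≠ ∞ := by simp [B, hCtop, ENNReal.mul_eq_top]
  have hlim : Tendsto (fun n : ℕ => ‖1 / √(n : ℝ) * (p a.1).scale P₀ a.2‖ₑ * B) atTop (𝓝 0) := by
    have h1 : Tendsto (fun n : ℕ => 1 / √(n : ℝ) * (p a.1).scale P₀ a.2) atTop (𝓝 0) := by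
      have := ((Real.tendsto_sqrt_atTop.comp tendsto_natCast_atTop_atTop).const_div_atTop 1).mul_const
        ((p a.1).scale P₀ a.2)
      simpa using this
    have h2 := ENNReal.Tendsto.mul_const (b := B) h1.enorm (Or.inr hB)
    simpa using h2
  refine tendsto_of_tendsto_of_tendsto_of_le_of_le' tendsto_const_nhds hlim
    (Eventually.of_forall fun _ => zero_le) ?_
  filter_upwards [(tendsto_natDiv_atTop hN).eventually_ge_atTop (s + h)] with n hn
  let T : ℕ → (ℕ → 𝔛) → ℝ := fun m => cellSum p P₀ a m
  have hT (m m' : ℕ) : AEStronglyMeasurable (fun x => T m x - T m' x) (iidLaw P₀) :=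
    (by fun_prop : Measurable fun x => cellSum p P₀ a m x - cellSum p P₀ a m' x)
      |>.aestronglyMeasurable
  let F : ℕ → (ℕ → 𝔛) → ℝ := fun i =>
    (fun x => T (h * blockEnd N s h n (κ + i)) x - T (n / N * (κ + i + 1)) x) -
      fun x => T (h * blockStart N h n (κ + i)) x - T (n / N * (κ + i)) x
  have hF (i : ℕ) : AEStronglyMeasurable (F i) (iidLaw P₀) := (hT _ _).sub (hT _ _)
  -- the block sums of `𝒳*` telescope up to the errors `F i` at the ends of the blocks
  have key : ((fun x => 1 / √(n : ℝ) * ((p a.1).scale P₀ a.2 *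
          (cellSum p P₀ a (β n) x - cellSum p P₀ a (α n) x)) -
        ∑ i ∈ Finset.range M, XStar p P₀ N s h n (κ + i) a x) - fun _ => (0 : ℝ)) =
      (1 / √(n : ℝ) * (p a.1).scale P₀ a.2) •
        (((fun x => T (β n) x - T (n / N * (κ + M)) x) - fun x => T (α n) x - T (n / N * κ) x) -
          ∑ i ∈ Finset.range M, F i) := by
    funext x
    have htel := Finset.sum_range_sub (fun i => T (n / N * (κ + i)) x) M
    have hXs : ∑ i ∈ Finset.range M, XStar p P₀ N s h n (κ + i) a x =
        (1 / √(n : ℝ) * (p a.1).scale P₀ a.2) * ∑ i ∈ Finset.range M,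
          (T (h * blockEnd N s h n (κ + i)) x - T (h * blockStart N h n (κ + i)) x) := by
      rw [Finset.mul_sum]
      refine Finset.sum_congr rfl fun i hi => ?_
      have hi' := Finset.mem_range.1 hi
      rw [XStar_eq_cellSum hp hL hh hn (by omega), mul_assoc]
    simp only [Pi.sub_apply, Pi.smul_apply, smul_eq_mul, Finset.sum_apply, F, hXs, sub_zero,
      Finset.sum_sub_distrib, ← add_assoc, add_zero] at htel ⊢
    simp only [T] at htel ⊢
    linear_combination -(1 / √(n : ℝ) * (p a.1).scale P₀ a.2) * htel
  rw [key, eLpNorm_const_smul]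
  gcongr
  refine (eLpNorm_sub_le ((hT _ _).sub (hT _ _)) (by fun_prop) le_rfl).trans (add_le_add
    ((eLpNorm_sub_le (hT _ _) (hT _ _) le_rfl).trans (add_le_add
      (eLpNorm_cellSum_sub_le a (hβ1 n) (hβ2 n)) (eLpNorm_cellSum_sub_le a (hα1 n) (hα2 n))))
    ((eLpNorm_sum_le (fun i _ => hF i) le_rfl).trans ?_))
  have hFi (i : ℕ) : eLpNorm (F i) 1 (iidLaw P₀) ≤
      ((s + h : ℕ) : ℝ≥0∞) * C + ((s + h : ℕ) : ℝ≥0∞) * C := by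
    have h1 := le_mul_blockStart (N := N) hh n (κ + i)
    have h2 := mul_blockStart_le (N := N) (h := h) n (κ + i)
    have h3 := le_mul_blockEnd (N := N) (s := s) hh n (κ + i)
    have h4 := mul_blockEnd_le (N := N) (s := s) (h := h) n (κ + i)
    exact (eLpNorm_sub_le (hT _ _) (hT _ _) le_rfl).trans (add_le_add
      (eLpNorm_cellSum_sub_le a (by omega) (by omega))
      (eLpNorm_cellSum_sub_le a (by omega) (by omega)))
  refine (Finset.sum_le_card_nsmul _ _ _ fun i _ => hFi i).trans ?_
  rw [nsmul_eq_mul, Finset.card_range]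

/-- The sum of all `𝒴_k` of a family is the sum of all `𝒳*_k`. -/
lemma sum_blockVec (hNlb : ∀ q, (p q).NLb ∣ N) (q : Fin Q) (j : Fin ((p q).KSb + 3))
    (v : ℕ → Idx p → ℝ) :
    ∑ k : Fin (p q).NLb, blockVec p N v ⟨q, k, j⟩ = ∑ k ∈ Finset.range N, v k ⟨q, j⟩ := by
  have hgen (m M : ℕ) : ∑ k ∈ Finset.range m, ∑ i ∈ Finset.range M, v (M * k + i) ⟨q, j⟩ =
      ∑ k ∈ Finset.range (M * m), v k ⟨q, j⟩ := by
    induction m with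
    | zero => simp
    | succ m ih => rw [Finset.sum_range_succ, ih, mul_add_one, Finset.sum_range_add]
  have h1 := hgen (p q).NLb (N / (p q).NLb)
  rw [Nat.div_mul_cancel (hNlb q)] at h1
  rw [← h1, Finset.sum_range]
  rfl

end Approximation

/-! ### The statistics as continuous functions of `𝒴` and of negligible errors -/

section Representation

variable {𝔛 : Type*} [MeasurableSpace 𝔛] {P₀ : Measure 𝔛} {Q : ℕ} {p : Fin Q → TripleParams 𝔛}
  {N h s : ℕ}

/-- The coordinate of the summing statistic. -/
abbrev idxSum (p : Fin Q → TripleParams 𝔛) (q : Fin Q) : Idx p :=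
  ⟨q, ⟨(p q).KSb + 2, by omega⟩⟩

/-- The coordinate of the long-block statistic. -/
abbrev idxLb (p : Fin Q → TripleParams 𝔛) (q : Fin Q) : Idx p :=
  ⟨q, ⟨(p q).KSb + 1, by omega⟩⟩

/-- The coordinates of the short-block statistic. -/
abbrev idxSb (p : Fin Q → TripleParams 𝔛) (q : Fin Q) (j : Fin ((p q).KSb + 1)) : Idx p :=
  ⟨q, ⟨j, by omega⟩⟩

/-- The sum of the summands of a coordinate over the positions `i`, `m ≤ i < m'`, with the
normalization of `𝒳*`. -/
noncomputable def normSum (p : Fin Q → TripleParams 𝔛) (P₀ : Measure 𝔛) (a : Idx p)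
    (n m m' : ℕ) (x : ℕ → 𝔛) : ℝ :=
  1 / √(n : ℝ) * ((p a.1).scale P₀ a.2 * (cellSum p P₀ a m' x - cellSum p P₀ a m x))

@[fun_prop]
lemma measurable_normSum (a : Idx p) (n m m' : ℕ) : Measurable (normSum p P₀ a n m m') := by
  unfold normSum; fun_prop

/-- The normalized sum behind `T_sum`. -/
noncomputable def totalSum (p : Fin Q → TripleParams 𝔛) (P₀ : Measure 𝔛) (q : Fin Q) (n : ℕ) :
    (ℕ → 𝔛) → ℝ :=
  normSum p P₀ (idxSum p q) n 0 (n + 1 - (p q).mSum)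

/-- The normalized sum over the long block number `k` behind `T_lb`. -/
noncomputable def longBlockSum (p : Fin Q → TripleParams 𝔛) (P₀ : Measure 𝔛) (q : Fin Q)
    (k n : ℕ) : (ℕ → 𝔛) → ℝ :=
  normSum p P₀ (idxLb p q) n (n / (p q).NLb * k)
    (n / (p q).NLb * k + (n / (p q).NLb + 1 - (p q).mLb))

/-- The normalized centred count of the short blocks in the part number `j` behind `T_sb`. -/
noncomputable def shortBlockSum (p : Fin Q → TripleParams 𝔛) (P₀ : Measure 𝔛) (q : Fin Q)
    (j : Fin ((p q).KSb + 1)) (n : ℕ) : (ℕ → 𝔛) → ℝ :=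
  normSum p P₀ (idxSb p q j) n 0 ((p q).LSb * (n / (p q).LSb))

/-- For `n + 1 ≤ m_sum` both sides are zero, since the sum is empty. -/
lemma TSum_eq (q : Fin Q) {n : ℕ} (hn : 0 < n) (x : ℕ → 𝔛) :
    (p q).TSum P₀ n x = √(n : ℝ) / √((n : ℝ) - (p q).mSum + 1) * totalSum p P₀ q n x := by
  have hs : √(n : ℝ) ≠ 0 := (Real.sqrt_pos.2 (by exact_mod_cast hn)).ne'
  simp only [TripleParams.TSum, totalSum, normSum, cellSum, TripleParams.cell, TripleParams.scale]
  simp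
  field_simp

lemma W_sub_eq (q : Fin Q) {n : ℕ} (hn : (p q).mLb ≤ n / (p q).NLb) (k : ℕ) (x : ℕ → 𝔛) :
    (p q).W n k x - (((n / (p q).NLb : ℕ) : ℝ) - (p q).mLb + 1) * meanH0 P₀ (p q).fLb =
      cellSum p P₀ (idxLb p q)
          (n / (p q).NLb * k + (n / (p q).NLb + 1 - (p q).mLb)) x -
        cellSum p P₀ (idxLb p q) (n / (p q).NLb * k) x := by
  have hc : ((n / (p q).NLb + 1 - (p q).mLb : ℕ) : ℝ) =
      ((n / (p q).NLb : ℕ) : ℝ) - (p q).mLb + 1 := by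
    rw [Nat.cast_sub (by omega)]
    push_cast
    ring
  rw [cellSum, cellSum, Finset.sum_range_add, add_sub_cancel_left, ← hc]
  simp [TripleParams.cell, TripleParams.W]

lemma TLb_eq (q : Fin Q) {n : ℕ} (hn0 : 0 < n) (hn : (p q).mLb ≤ n / (p q).NLb) (x : ℕ → 𝔛) :
    (p q).TLb P₀ n x = (n : ℝ) / ((p q).NLb * (n / (p q).NLb : ℕ)) *
      ((p q).NLb * ∑ k : Fin (p q).NLb, longBlockSum p P₀ q k n x ^ 2) := by
  have hs : (√(n : ℝ)) ^ 2 = n := Real.sq_sqrt (by positivity)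
  have hn' : (n : ℝ) ≠ 0 := by exact_mod_cast hn0.ne'
  have hNLb : ((p q).NLb : ℝ) ≠ 0 := by exact_mod_cast (p q).NLb_pos.ne'
  have hsc : (p q).scale P₀ (idxLb p q).2 = ((p q).σLb P₀)⁻¹ := by simp [TripleParams.scale]
  simp only [TripleParams.TLb, W_sub_eq q hn, longBlockSum, normSum, hsc]
  rw [Finset.sum_range (n := (p q).NLb)]
  simp only [mul_pow, div_pow, one_pow, hs, inv_pow, ← Finset.mul_sum]
  field_simp

lemma TSb_eq (q : Fin Q) {n : ℕ} (hn0 : 0 < n) (x : ℕ → 𝔛) :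
    (p q).TSb P₀ n x = (n : ℝ) / ((p q).LSb * (n / (p q).LSb : ℕ)) *
      ((p q).LSb * ∑ j, shortBlockSum p P₀ q j n x ^ 2) := by
  have hs : (√(n : ℝ)) ^ 2 = n := Real.sq_sqrt (by positivity)
  have hn' : (n : ℝ) ≠ 0 := by exact_mod_cast hn0.ne'
  have hLSb : ((p q).LSb : ℝ) ≠ 0 := by exact_mod_cast (p q).LSb_pos.ne'
  have hcs (j : Fin ((p q).KSb + 1)) :
      cellSum p P₀ (idxSb p q j) ((p q).LSb * (n / (p q).LSb)) x =
        (p q).w n j x - ((n / (p q).LSb : ℕ) : ℝ) * (p q).ESb P₀ j := by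
    simp only [cellSum, TripleParams.cell, j.2, dif_pos, TripleParams.w]
    rw [sum_range_mul_ite_dvd (p q).LSb_pos (n / (p q).LSb)
        (fun u => ((p q).fSb ⁻¹' (p q).α j).indicator (fun _ => (1 : ℝ)) (window (p q).LSb u x)
          - (p q).ESb P₀ j), Finset.sum_sub_distrib]
    simp
  have hsc (j : Fin ((p q).KSb + 1)) :
      (p q).scale P₀ (idxSb p q j).2 = 1 / √((p q).ESb P₀ j) := by
    rw [TripleParams.scale, dif_pos j.2]
  have hE (j : Fin ((p q).KSb + 1)) : (√((p q).ESb P₀ j)) ^ 2 = (p q).ESb P₀ j :=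
    Real.sq_sqrt measureReal_nonneg
  have hz (a : Idx p) : cellSum p P₀ a 0 x = 0 := by simp [cellSum]
  simp only [TripleParams.TSb, shortBlockSum, normSum, hcs, hz, sub_zero, hsc, Finset.mul_sum]
  refine Finset.sum_congr rfl fun j _ => ?_
  simp only [mul_pow, div_pow, one_pow, hs, hE]
  field_simp

/-- The indices of the errors in the approximation of the statistics by functions of `𝒴`: the
additive errors of the normalized sums behind `T_sum`, `T_lb`, `T_sb`, and the ratios of the
normalizing factors of these statistics and of `𝒴`. -/
abbrev ErrIdx (p : Fin Q → TripleParams 𝔛) : Type :=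
  Fin Q ⊕ (Σ q : Fin Q, Fin (p q).NLb) ⊕ (Σ q : Fin Q, Fin ((p q).KSb + 1)) ⊕
    Fin Q ⊕ Fin Q ⊕ Fin Q

/-- The errors in the approximation of the statistics by functions of `𝒴`. -/
noncomputable def errVec (p : Fin Q → TripleParams 𝔛) (P₀ : Measure 𝔛) (N s h n : ℕ)
    (x : ℕ → 𝔛) : ErrIdx p → ℝ :=
  Sum.elim (fun q => totalSum p P₀ q n x - sumForm p q (YVec p P₀ N s h n x)) <|
  Sum.elim (fun b => longBlockSum p P₀ b.1 b.2 n x -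
    YVec p P₀ N s h n x ⟨b.1, b.2, (idxLb p b.1).2⟩) <|
  Sum.elim (fun b => shortBlockSum p P₀ b.1 b.2 n x -
    ∑ k, YVec p P₀ N s h n x ⟨b.1, k, (idxSb p b.1 b.2).2⟩) <|
  Sum.elim (fun q => √(n : ℝ) / √((n : ℝ) - (p q).mSum + 1)) <|
  Sum.elim (fun q => (n : ℝ) / ((p q).NLb * (n / (p q).NLb : ℕ)))
    (fun q => (n : ℝ) / ((p q).LSb * (n / (p q).LSb : ℕ)))

/-- The limits of the errors: zero for the additive errors, one for the ratios. -/
def errLim (p : Fin Q → TripleParams 𝔛) : ErrIdx p → ℝ :=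
  Sum.elim 0 (Sum.elim 0 (Sum.elim 0 (Sum.elim 1 (Sum.elim 1 1))))

/-- All statistics as a function of the vector `c = 𝒴` and of the vector `e` of the errors. -/
noncomputable def statMap {J : ℕ} (p : Fin Q → TripleParams 𝔛) {τ : Fin J → ℕ}
    (d : ∀ j : Fin J, Fin (τ j) → Fin Q → ℝ) (z : (BlockIdx p → ℝ) × (ErrIdx p → ℝ)) :
    (Fin Q → ℝ × ℝ × ℝ) × (Fin J → ℝ) :=
  let t : Fin Q → ℝ := fun q => z.2 (.inr <| .inr <| .inr <| .inl q) *
    (sumForm p q z.1 + z.2 (.inl q))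
  (fun q => (t q,
    z.2 (.inr <| .inr <| .inr <| .inr <| .inl q) *
      ((p q).NLb * ∑ k : Fin (p q).NLb,
        (z.1 ⟨q, k, (idxLb p q).2⟩ + z.2 (.inr <| .inl ⟨q, k⟩)) ^ 2),
    z.2 (.inr <| .inr <| .inr <| .inr <| .inr q) *
      ((p q).LSb * ∑ j, (∑ k, z.1 ⟨q, k, (idxSb p q j).2⟩ +
        z.2 (.inr <| .inr <| .inl ⟨q, j⟩)) ^ 2)),
    fun j => ∑ i, (∑ q, d j i q * t q) ^ 2)

/-- The vector of all statistics. -/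
noncomputable def statVec {J : ℕ} (p : Fin Q → TripleParams 𝔛) {τ : Fin J → ℕ}
    (d : ∀ j : Fin J, Fin (τ j) → Fin Q → ℝ) (P₀ : Measure 𝔛) (n : ℕ) (x : ℕ → 𝔛) :
    (Fin Q → ℝ × ℝ × ℝ) × (Fin J → ℝ) :=
  (fun q => ((p q).TSum P₀ n x, (p q).TLb P₀ n x, (p q).TSb P₀ n x),
    fun j => TQuad p (d j) P₀ n x)

/-- The vector of the functions of `𝒴` which approximate the statistics. -/
noncomputable def formVec {J : ℕ} (p : Fin Q → TripleParams 𝔛) {τ : Fin J → ℕ}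
    (d : ∀ j : Fin J, Fin (τ j) → Fin Q → ℝ) (c : BlockIdx p → ℝ) :
    (Fin Q → ℝ × ℝ × ℝ) × (Fin J → ℝ) :=
  (fun q => (sumForm p q c, lbForm p q c, sbForm p q c), fun j => quadForm p (d j) c)

variable {J : ℕ} {τ : Fin J → ℕ} {d : ∀ j : Fin J, Fin (τ j) → Fin Q → ℝ}

@[fun_prop]
lemma continuous_sumForm (q : Fin Q) : Continuous (sumForm p q) := by
  unfold sumForm; fun_prop

lemma continuous_statMap : Continuous (statMap p d) := by
  unfold statMap
  fun_prop

lemma continuous_formVec : Continuous (formVec p d) := by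
  unfold formVec quadForm lbForm sbForm
  fun_prop

lemma statMap_errLim (c : BlockIdx p → ℝ) : statMap p d (c, errLim p) = formVec p d c := by
  simp [statMap, formVec, errLim, lbForm, sbForm, quadForm]

lemma eventually_statVec_eq (p : Fin Q → TripleParams 𝔛) (d : ∀ j : Fin J, Fin (τ j) → Fin Q → ℝ)
    (P₀ : Measure 𝔛) (N s h : ℕ) :
    ∀ᶠ n in atTop, ∀ x, statMap p d (YVec p P₀ N s h n x, errVec p P₀ N s h n x) =
      statVec p d P₀ n x := by
  have h1 : ∀ᶠ n in atTop, ∀ q, (p q).mLb ≤ n / (p q).NLb := eventually_all.2 fun q =>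
    (tendsto_natDiv_atTop (p q).NLb_pos).eventually_ge_atTop _
  filter_upwards [h1, eventually_gt_atTop 0] with n hn hn0 x
  have hT (q : Fin Q) : √(n : ℝ) / √((n : ℝ) - (p q).mSum + 1) *
      (sumForm p q (YVec p P₀ N s h n x) +
        (totalSum p P₀ q n x - sumForm p q (YVec p P₀ N s h n x))) = (p q).TSum P₀ n x := by
    rw [add_sub_cancel, TSum_eq q hn0]
  simp only [statMap, statVec, errVec, Sum.elim_inl, Sum.elim_inr, hT, TQuad, Prod.mk.injEq,
    and_true]
  funext q
  simp only [add_sub_cancel, TLb_eq q hn0 (hn q), TSb_eq q hn0]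

end Representation

/-! ### Limits of the errors -/

section ErrorLimits

variable {𝔛 : Type*} [MeasurableSpace 𝔛] {P₀ : Measure 𝔛} {Q : ℕ} {p : Fin Q → TripleParams 𝔛}
  {N h s : ℕ}

lemma tendstoInMeasure_pi {Ω ι E : Type*} [MeasurableSpace Ω] {μ : Measure Ω} [Fintype ι]
    [SeminormedAddCommGroup E] {l : Filter ℕ} {f : ℕ → Ω → ι → E} {g : Ω → ι → E}
    (hfg : ∀ i, TendstoInMeasure μ (fun n ω => f n ω i) l fun ω => g ω i) :
    TendstoInMeasure μ f l g := by
  simp only [tendstoInMeasure_iff_norm] at hfg ⊢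
  intro ε hε
  have h1 : Tendsto (fun n => ∑ i, μ {ω | ε ≤ ‖f n ω i - g ω i‖}) l (𝓝 0) := by
    have := tendsto_finsetSum Finset.univ fun i _ => hfg i ε hε
    simpa using this
  refine tendsto_of_tendsto_of_tendsto_of_le_of_le tendsto_const_nhds h1 (fun _ => zero_le)
    fun n => ?_
  refine (measure_mono fun ω hω => ?_).trans (measure_iUnion_fintype_le _ _)
  by_contra hcon
  simp only [Set.mem_iUnion, Set.mem_ofPred_eq, not_exists, not_le] at hcon hω
  exact absurd ((pi_norm_lt_iff hε).2 hcon) hω.not_gt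

lemma tendsto_natCast_div_mul_natDiv {m : ℕ} (hm : 0 < m) :
    Tendsto (fun n : ℕ => (n : ℝ) / (m * (n / m : ℕ))) atTop (𝓝 1) := by
  have hm' : (m : ℝ) ≠ 0 := by exact_mod_cast hm.ne'
  have h1 := ((tendsto_natDiv_div hm).const_mul (m : ℝ)).inv₀ (by simp [hm'])
  rw [mul_one_div_cancel hm', inv_one] at h1
  refine h1.congr fun n => ?_
  rw [← mul_div_assoc, inv_div]

lemma tendsto_sqrt_div_sqrt (m : ℕ) :
    Tendsto (fun n : ℕ => √(n : ℝ) / √((n : ℝ) - m + 1)) atTop (𝓝 1) := by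
  have h1 : Tendsto (fun n : ℕ => ((n : ℝ) - m + 1) / n) atTop (𝓝 1) := by
    refine tendsto_div_of_abs_sub_le (D := m + 1) (Eventually.of_forall fun n => ?_)
    rw [abs_le]
    constructor <;> linarith [(Nat.cast_nonneg m : (0 : ℝ) ≤ m)]
  have h2 := (h1.inv₀ one_ne_zero).sqrt
  rw [inv_one, Real.sqrt_one] at h2
  refine h2.congr fun n => ?_
  rw [inv_div, Real.sqrt_div (Nat.cast_nonneg n)]

@[fun_prop]
lemma measurable_YVec (N s h n : ℕ) : Measurable (YVec p P₀ N s h n) := by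
  unfold YVec blockVec
  exact measurable_pi_lambda _ fun _ => Finset.measurable_sum _ fun _ _ =>
    measurable_XStar _ _ _ _ _ _

lemma measurable_errVec (N s h n : ℕ) : Measurable (errVec p P₀ N s h n) := by
  have hY (b : BlockIdx p) : Measurable fun x => YVec p P₀ N s h n x b :=
    (measurable_pi_apply b).comp (measurable_YVec N s h n)
  refine measurable_pi_lambda _ fun i => ?_
  rcases i with q | b | b | q | q | q <;> simp only [errVec, Sum.elim_inl, Sum.elim_inr]
  · exact (measurable_normSum _ _ _ _).sub
      ((continuous_sumForm q).measurable.comp (measurable_YVec N s h n))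
  · exact (measurable_normSum _ _ _ _).sub (hY _)
  · exact (measurable_normSum _ _ _ _).sub (Finset.measurable_sum _ fun k _ => hY _)
  · exact measurable_const
  · exact measurable_const
  · exact measurable_const

/-- The errors converge in probability to their limits. -/
lemma tendstoInMeasure_errVec [IsProbabilityMeasure P₀] (hp : ∀ q, (p q).WellDefined P₀)
    (hL : ∀ q, (p q).LSb ∣ h) (hN : 0 < N) (hh : 0 < h) (hNlb : ∀ q, (p q).NLb ∣ N) :
    TendstoInMeasure (iidLaw P₀) (fun n x => errVec p P₀ N s h n x) atTop fun _ => errLim p := by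
  have hconst {c : ℕ → ℝ} {c₀ : ℝ} (hc : Tendsto c atTop (𝓝 c₀)) :
      TendstoInMeasure (iidLaw P₀) (fun n _ => c n) atTop (fun _ => c₀) :=
    tendstoInMeasure_of_tendsto_ae (fun n => aestronglyMeasurable_const) (ae_of_all _ fun _ => hc)
  have hdiv (n : ℕ) : n / N * N ≤ n ∧ n ≤ n / N * N + N :=
    ⟨Nat.div_mul_le_self n N, (Nat.lt_div_mul_add hN).le⟩
  refine tendstoInMeasure_pi fun i => ?_
  rcases i with q | ⟨q, k⟩ | ⟨q, j⟩ | q | q | q <;>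
    simp only [errVec, errLim, Sum.elim_inl, Sum.elim_inr, Pi.zero_apply, Pi.one_apply]
  · have h1 := tendstoInMeasure_cellSum_sub (s := s) hp hL hN hh (idxSum p q) (κ := 0) (M := N)
      (D := N + (p q).mSum) (by simp) (α := fun _ => 0) (β := fun n => n + 1 - (p q).mSum)
      (by simp) (by simp)
      (fun n => by
        have := hdiv n; have := (p q).mSum_pos; rw [zero_add]; omega)
      (fun n => by have := hdiv n; rw [zero_add]; omega)
    simpa only [totalSum, normSum, sumForm, YVec, sum_blockVec hNlb, zero_add] using h1
  · obtain ⟨M, hM⟩ := hNlb q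
    have hNLb := (p q).NLb_pos
    have hNM : N / (p q).NLb = M := by rw [hM, Nat.mul_div_cancel_left _ hNLb]
    -- `M ⌊n / N⌋` and `⌊n / N_lb⌋` differ by at most `M`
    have hb1 (n : ℕ) : n / N * M ≤ n / (p q).NLb := by
      rw [Nat.le_div_iff_mul_le hNLb, mul_assoc, mul_comm M, ← hM]
      exact (hdiv n).1
    have hb2 (n : ℕ) : n / (p q).NLb ≤ n / N * M + M := by
      refine (Nat.lt_of_mul_lt_mul_right (a := (p q).NLb) ?_).le
      rw [add_mul, mul_assoc, mul_comm M, ← hM]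
      exact (Nat.div_mul_le_self _ _).trans_lt (Nat.lt_div_mul_add hN)
    have hkM : M * (k : ℕ) + M ≤ N := by
      rw [hM, mul_comm _ M, ← mul_add_one]
      exact Nat.mul_le_mul_left _ k.2
    have hc1 (n c : ℕ) : n / N * (M * c) ≤ n / (p q).NLb * c := by
      rw [← mul_assoc]; exact Nat.mul_le_mul_right _ (hb1 n)
    have hc2 (n c : ℕ) : n / (p q).NLb * c ≤ n / N * (M * c) + M * c := by
      rw [← mul_assoc, ← add_mul]; exact Nat.mul_le_mul_right _ (hb2 n)
    have hk1 (n : ℕ) : n / (p q).NLb * ((k : ℕ) + 1) = n / (p q).NLb * k + n / (p q).NLb :=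
      mul_add_one _ _
    have h1 := tendstoInMeasure_cellSum_sub (s := s) hp hL hN hh (idxLb p q) (κ := M * k) (M := M)
      (D := N + (p q).mLb) hkM (α := fun n => n / (p q).NLb * k)
      (β := fun n => n / (p q).NLb * k + (n / (p q).NLb + 1 - (p q).mLb))
      (fun n => by have := hc2 n k; omega) (fun n => by have := hc1 n k; omega)
      (fun n => by
        have h2 := hc2 n (k + 1)
        have := (p q).mLb_pos
        rw [← mul_add_one M]
        rw [hk1] at h2
        rw [mul_add_one M] at h2 ⊢
        generalize n / (p q).NLb = L at h2 ⊢
        omega)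
      (fun n => by
        have := hc1 n (k + 1)
        rw [← mul_add_one M]; rw [hk1] at this; omega)
    simpa only [longBlockSum, normSum, YVec, blockVec, hNM] using h1
  · have hd (n : ℕ) : (p q).LSb * (n / (p q).LSb) ≤ n ∧
        n ≤ (p q).LSb * (n / (p q).LSb) + (p q).LSb :=
      ⟨Nat.mul_div_le _ _, by
        have := Nat.lt_mul_div_succ n (p q).LSb_pos
        rw [mul_add_one] at this; omega⟩
    have h1 := tendstoInMeasure_cellSum_sub (s := s) hp hL hN hh (idxSb p q j) (κ := 0) (M := N)
      (D := N + (p q).LSb) (by simp) (α := fun _ => 0)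
      (β := fun n => (p q).LSb * (n / (p q).LSb)) (by simp) (by simp)
      (fun n => by have := hdiv n; have := hd n; rw [zero_add]; omega)
      (fun n => by have := hdiv n; have := hd n; rw [zero_add]; omega)
    simpa only [shortBlockSum, normSum, YVec, sum_blockVec hNlb, zero_add] using h1
  · exact hconst (tendsto_sqrt_div_sqrt _)
  · exact hconst (tendsto_natCast_div_mul_natDiv (p q).NLb_pos)
  · exact hconst (tendsto_natCast_div_mul_natDiv (p q).LSb_pos)

end ErrorLimits

/-! ### Transfer from one i.i.d. sequence to series schemes -/

section Transfer

variable {Ω : ℕ → Type*} [∀ n, MeasurableSpace (Ω n)] {μ : ∀ n, Measure (Ω n)}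
  [∀ n, IsProbabilityMeasure (μ n)] {Ω' : Type*} [MeasurableSpace Ω'] {μ' : Measure Ω'}
  [IsProbabilityMeasure μ']

lemma tendstoInDistribution_congr_eventually {E : Type*} [TopologicalSpace E] [MeasurableSpace E]
    [OpensMeasurableSpace E] {X X' : ∀ n, Ω n → E} {Z : Ω' → E}
    (h : TendstoInDistribution X atTop Z μ μ') (hm : ∀ n, AEMeasurable (X' n) (μ n))
    (he : ∀ᶠ n in atTop, X n = X' n) : TendstoInDistribution X' atTop Z μ μ' :=
  ⟨hm, h.aemeasurable_limit, h.tendsto.congr' (he.mono fun n hn => Subtype.ext (by simp [hn]))⟩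

/-- Convergence in distribution of functionals of the first `n` elements, proved for one infinite
i.i.d. sequence, holds for every series scheme which satisfies `H₀`. -/
lemma tendstoInDistribution_of_isH0 {𝔛 : Type*} [MeasurableSpace 𝔛] {P₀ : Measure 𝔛}
    [IsProbabilityMeasure P₀] {ε : ∀ n, ℕ → Ω n → 𝔛} (hε : IsH0 P₀ μ ε)
    {E : Type*} [TopologicalSpace E] [MeasurableSpace E] [OpensMeasurableSpace E]
    {F : ℕ → (ℕ → 𝔛) → E} {Z : Ω' → E} (hF : ∀ n, Measurable (F n))
    (hd : ∀ n, DependsOn (F n) (Set.Iio n))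
    (h : TendstoInDistribution F atTop Z (fun _ => iidLaw P₀) μ') :
    TendstoInDistribution (fun n ω => F n fun i => ε n i ω) atTop Z μ μ' := by
  have hl (n : ℕ) := hasLaw_of_dependsOn (hε n).1 (hε n).2 (hF n) (hd n)
  refine ⟨fun n => (hl n).aemeasurable, h.aemeasurable_limit, ?_⟩
  exact h.tendsto.congr fun n => Subtype.ext (hl n).map_eq.symm

/-- Convergence in distribution to zero is convergence in probability to zero. -/
lemma IsLittleOP.of_tendstoInDistribution {D : ∀ n, Ω n → ℝ}
    (h : TendstoInDistribution D atTop (fun _ => (0 : ℝ)) μ μ') : IsLittleOP μ D := by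
  intro δ hδ
  have hcl : MeasurableSet {y : ℝ | δ ≤ |y|} := measurableSet_le measurable_const (by fun_prop)
  have hsub : frontier {y : ℝ | δ ≤ |y|} ⊆ {y : ℝ | δ = |y|} :=
    frontier_le_subset_eq continuous_const continuous_abs
  have hmap : μ'.map (fun _ => (0 : ℝ)) = Measure.dirac 0 := by simp
  have h1 := ProbabilityMeasure.tendsto_measure_of_null_frontier_of_tendsto' h.tendsto
    (E := {y : ℝ | δ ≤ |y|}) (by
      refine measure_mono_null hsub ?_
      rw [ProbabilityMeasure.coe_mk, hmap, Measure.dirac_apply]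
      simp [hδ.ne'])
  simp only [ProbabilityMeasure.coe_mk, hmap, Measure.dirac_apply] at h1
  have h0 : ({y : ℝ | δ ≤ |y|}.indicator 1 0 : ℝ≥0∞) = 0 := by simp [hδ]
  rw [h0] at h1
  refine h1.congr fun n => ?_
  rw [Measure.map_apply_of_aemeasurable (h.forall_aemeasurable n) hcl]
  rfl

end Transfer

/-! ### The joint limit theorem -/

section Statistics

variable {𝔛 : Type*} [MeasurableSpace 𝔛] {P₀ : Measure 𝔛} {Q J : ℕ}
  {p : Fin Q → TripleParams 𝔛} {τ : Fin J → ℕ} {d : ∀ j : Fin J, Fin (τ j) → Fin Q → ℝ}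
  {N h s : ℕ}

lemma measurable_TSum (p : TripleParams 𝔛) (P₀ : Measure 𝔛) (n : ℕ) :
    Measurable (p.TSum P₀ n) := by
  have := p.measurable_fSum
  unfold TripleParams.TSum
  fun_prop

lemma measurable_TLb (p : TripleParams 𝔛) (P₀ : Measure 𝔛) (n : ℕ) :
    Measurable (p.TLb P₀ n) := by
  have := p.measurable_fLb
  unfold TripleParams.TLb TripleParams.W
  fun_prop

lemma measurable_TSb (p : TripleParams 𝔛) (P₀ : Measure 𝔛) (n : ℕ) :
    Measurable (p.TSb P₀ n) := by
  have hw (j : Fin (p.KSb + 1)) : Measurable (p.w n j) :=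
    Finset.measurable_sum _ fun i _ =>
      (measurable_const.indicator (p.measurableSet_preimage j)).comp (measurable_window _ _)
  unfold TripleParams.TSb
  fun_prop

lemma measurable_statVec (n : ℕ) : Measurable (statVec p d P₀ n) := by
  have h1 (q : Fin Q) := measurable_TSum (p q) P₀ n
  have h2 (q : Fin Q) := measurable_TLb (p q) P₀ n
  have h3 (q : Fin Q) := measurable_TSb (p q) P₀ n
  unfold statVec TQuad
  fun_prop

lemma dependsOn_TSum (p : TripleParams 𝔛) (P₀ : Measure 𝔛) (n : ℕ) :
    DependsOn (p.TSum P₀ n) (Set.Iio n) := by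
  intro x y hxy
  unfold TripleParams.TSum
  congr 1
  refine Finset.sum_congr rfl fun i hi => ?_
  have := Finset.mem_range.1 hi
  rw [window_congr (by omega) hxy]

lemma dependsOn_TLb (p : TripleParams 𝔛) (P₀ : Measure 𝔛) (n : ℕ) :
    DependsOn (p.TLb P₀ n) (Set.Iio n) := by
  intro x y hxy
  unfold TripleParams.TLb TripleParams.W
  congr 1
  refine Finset.sum_congr rfl fun k hk => ?_
  congr 2
  refine Finset.sum_congr rfl fun i hi => ?_
  have h1 := Finset.mem_range.1 hi
  have h2 : n / p.NLb * (k + 1) ≤ n / p.NLb * p.NLb :=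
    Nat.mul_le_mul_left _ (Finset.mem_range.1 hk)
  have h3 := Nat.div_mul_le_self n p.NLb
  rw [mul_add_one] at h2
  rw [window_congr (by omega) hxy]

lemma dependsOn_TSb (p : TripleParams 𝔛) (P₀ : Measure 𝔛) (n : ℕ) :
    DependsOn (p.TSb P₀ n) (Set.Iio n) := by
  intro x y hxy
  have hw (j : Fin (p.KSb + 1)) : p.w n j x = p.w n j y := by
    refine Finset.sum_congr rfl fun i hi => ?_
    have h2 : p.LSb * (i + 1) ≤ p.LSb * (n / p.LSb) :=
      Nat.mul_le_mul_left _ (Finset.mem_range.1 hi)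
    have h3 := Nat.mul_div_le n p.LSb
    rw [mul_add_one] at h2
    rw [window_congr (by omega) hxy]
  simp only [TripleParams.TSb, hw]

lemma dependsOn_statVec (n : ℕ) : DependsOn (statVec p d P₀ n) (Set.Iio n) := by
  intro x y hxy
  simp only [statVec, TQuad, dependsOn_TSum (p _) P₀ n hxy, dependsOn_TLb (p _) P₀ n hxy,
    dependsOn_TSb (p _) P₀ n hxy]

lemma dependsOn_YVec (hL : ∀ q, (p q).LSb ∣ h) (hs : sMin p h ≤ s) (hNlb : ∀ q, (p q).NLb ∣ N)
    (n : ℕ) : DependsOn (YVec p P₀ N s h n) (Set.Iio n) := by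
  intro x y hxy
  funext b
  simp only [YVec, blockVec]
  refine Finset.sum_congr rfl fun i hi => ?_
  refine dependsOn_XStar hs hL n _ _ fun t ht => hxy t ?_
  have h1 : N / (p b.1).NLb * (b.2.1 : ℕ) + i + 1 ≤ N := mul_natDiv_add_lt (hNlb b.1) b.2.1.2
    (Finset.mem_range.1 hi)
  have h2 := (Nat.mul_le_mul_left (n / N) h1).trans (Nat.div_mul_le_self n N)
  rw [mul_add_one] at h2
  exact ht.2.trans_le h2

/-- The joint limit theorem for one infinite i.i.d. sequence. -/
lemma tendstoInDistribution_YVec_statVec [IsProbabilityMeasure P₀]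
    (d : ∀ j : Fin J, Fin (τ j) → Fin Q → ℝ) (hp : ∀ q, (p q).WellDefined P₀)
    (hL : ∀ q, (p q).LSb ∣ h) (hs : sMin p h ≤ s) (hN : 0 < N) (hh : 0 < h)
    (hNlb : ∀ q, (p q).NLb ∣ N)
    {Ω' : Type*} [MeasurableSpace Ω'] {μ' : Measure Ω'} [IsProbabilityMeasure μ']
    {η : ℕ → Ω' → EuclideanSpace ℝ (Idx p)} (hη_indep : iIndepFun (fun k : Fin N => η k) μ')
    (hη_law : ∀ k : Fin N, HasLaw (η k)
      (multivariateGaussian 0 ((1 / ((N : ℝ) * h)) • PhiStar p P₀ s h)) μ') :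
    TendstoInDistribution (fun n x => (YVec p P₀ N s h n x, statVec p d P₀ n x)) atTop
      (fun ω => (blockVec p N fun k a => η k ω a, formVec p d (blockVec p N fun k a => η k ω a)))
      (fun _ => iidLaw P₀) μ' := by
  have h1 := (tendstoInDistribution_YVec hp hL hs hN hh hNlb hη_indep
    hη_law).continuous_comp_prodMk_of_tendstoInMeasure_const
    (g := fun z => (z.1, statMap p d z)) (continuous_fst.prodMk continuous_statMap)
    (tendstoInMeasure_errVec (s := s) hp hL hN hh hNlb)
    (fun n => (measurable_errVec N s h n).aemeasurable)
  simp only [statMap_errLim] at h1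
  refine tendstoInDistribution_congr_eventually h1
    (fun n => ((measurable_YVec N s h n).prodMk (measurable_statVec n)).aemeasurable) ?_
  filter_upwards [eventually_statVec_eq p d P₀ N s h] with n hn
  funext x
  rw [hn]

end Statistics

end JointLimit

open JointLimit
theorem corollary2
    {𝔛 : Type*} [MeasurableSpace 𝔛] (P₀ : Measure 𝔛) [IsProbabilityMeasure P₀]
    -- the parameters of the statistics
    {Q J : ℕ} (p : Fin Q → TripleParams 𝔛) (hp : ∀ q, (p q).WellDefined P₀)
    (τ : Fin J → ℕ) (d : ∀ j : Fin J, Fin (τ j) → Fin Q → ℝ)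
    (N s h : ℕ) (hN : 0 < N) (hh : 0 < h) (hs : sMin p h ≤ s)
    (hNlb : ∀ q, (p q).NLb ∣ N) (hLsb : ∀ q, (p q).LSb ∣ h)
    -- the tested sequence, under the hypothesis `H₀`
    {Ω : ℕ → Type*} [∀ n, MeasurableSpace (Ω n)] (μ : ∀ n, Measure (Ω n))
    [∀ n, IsProbabilityMeasure (μ n)] (ε : ∀ n, ℕ → Ω n → 𝔛) (hε : IsH0 P₀ μ ε)
    -- the independent Gaussian vectors `η*₁, …, η*_N` (numbered from zero)
    {Ω' : Type*} [MeasurableSpace Ω'] (μ' : Measure Ω') [IsProbabilityMeasure μ']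
    (η : ℕ → Ω' → EuclideanSpace ℝ (Idx p))
    (hη_indep : iIndepFun (fun k : Fin N => η k) μ')
    (hη_law : ∀ k : Fin N, HasLaw (η k)
      (multivariateGaussian 0 ((1 / ((N : ℝ) * h)) • PhiStar p P₀ s h)) μ') :
    let x : ∀ n, Ω n → ℕ → 𝔛 := fun n ω i => ε n i ω
    let Y : ∀ n, Ω n → BlockIdx p → ℝ := fun n ω => YVec p P₀ N s h n (x n ω)
    let ζ : Ω' → BlockIdx p → ℝ := fun ω => blockVec p N (fun k a => η k ω a)
    (∀ q, IsLittleOP μ (fun n ω => (p q).TSum P₀ n (x n ω) - sumForm p q (Y n ω))) ∧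
    (∀ q, IsLittleOP μ (fun n ω => (p q).TLb P₀ n (x n ω) - lbForm p q (Y n ω))) ∧
    (∀ q, IsLittleOP μ (fun n ω => (p q).TSb P₀ n (x n ω) - sbForm p q (Y n ω))) ∧
    (∀ j, IsLittleOP μ (fun n ω => TQuad p (d j) P₀ n (x n ω) - quadForm p (d j) (Y n ω))) ∧
    TendstoInDistribution Y atTop ζ μ μ' ∧
    TendstoInDistribution
      (fun n ω =>
        ((fun q => ((p q).TSum P₀ n (x n ω), (p q).TLb P₀ n (x n ω), (p q).TSb P₀ n (x n ω)),
          fun j => TQuad p (d j) P₀ n (x n ω)) :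
          (Fin Q → ℝ × ℝ × ℝ) × (Fin J → ℝ)))
      atTop
      (fun ω =>
        (fun q => (sumForm p q (ζ ω), lbForm p q (ζ ω), sbForm p q (ζ ω)),
          fun j => quadForm p (d j) (ζ ω)))
      μ μ' := by
  intro x Y ζ
  have hmain : TendstoInDistribution
      (fun n ω => (Y n ω, statVec p d P₀ n (x n ω))) atTop
      (fun ω => (ζ ω, formVec p d (ζ ω))) μ μ' :=
    tendstoInDistribution_of_isH0 hε
      (F := fun n x => (YVec p P₀ N s h n x, statVec p d P₀ n x))
      (fun n => (measurable_YVec N s h n).prodMk (measurable_statVec n))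
      (fun n x y hxy => Prod.ext (dependsOn_YVec hLsb hs hNlb n hxy) (dependsOn_statVec n hxy))
      (tendstoInDistribution_YVec_statVec d hp hLsb hs hN hh hNlb hη_indep hη_law)
  have hdiff {g : ((Fin Q → ℝ × ℝ × ℝ) × (Fin J → ℝ)) → ℝ} (hg : Continuous g) :
      TendstoInDistribution
        (fun n ω => g (statVec p d P₀ n (x n ω)) - g (formVec p d (Y n ω))) atTop
        (fun _ => (0 : ℝ)) μ μ' := by
    have h1 := hmain.continuous_comp (g := fun z => g z.2 - g (formVec p d z.1))
      ((hg.comp continuous_snd).sub (hg.comp (continuous_formVec.comp continuous_fst)))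
    simpa [Function.comp_def] using h1
  refine ⟨fun q => .of_tendstoInDistribution (hdiff (g := fun z => (z.1 q).1) (by fun_prop)),
    fun q => .of_tendstoInDistribution (hdiff (g := fun z => (z.1 q).2.1) (by fun_prop)),
    fun q => .of_tendstoInDistribution (hdiff (g := fun z => (z.1 q).2.2) (by fun_prop)),
    fun j => .of_tendstoInDistribution (hdiff (g := fun z => z.2 j) (by fun_prop)),
    hmain.continuous_comp (g := Prod.fst) continuous_fst,
    hmain.continuous_comp (g := Prod.snd) continuous_snd⟩
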